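/- Let $(\epsilon_i)_{i\in\mathbb Z}$ be i.i.d. real random variables with mean zero, finite variance $\sigma^2$ ($\sigma\ge 0$) and median zero, whose common law has a differentiable density $f$ on $\mathbb R$ with $f(0)>0$ and $\sup_{x\in\mathbb R}|f'(x)|<\infty$. Let $(\rho_n)_{n\ge1}$ be real numbers with $0<\rho_n<1$ for all $n\geq 1$ and $n(\rho_n-1)\to0$ as $n\to\infty$. For each $n\ge1$ let $$y_0=\sum_{j=0}^{\infty}\rho_n^{j}\epsilon_{-j},\qquad y_i=\rho_n y_{i-1}+\epsilon_i\quad(1\le i\le n),$$ where the dependence of $y_i$ on $n$ is suppressed (the series converges almost surely). Let $\hat\rho_{\rm LAD}$ (also depending on $n$) be any least absolute deviation estimator, that is, any random variable which almost surely minimises $$\rho\mapsto\frac1n\sum_{i=1}^n|y_i-\rho y_{i-1}|$$ over $\rho\in\mathbb R$. Then, as $n\to\infty$, $$\sqrt{\frac{n}{1-\rho_n^2}}\,(\hat\rho_{\rm LAD}-\rho_n)\to_d\frac{\mathcal C}{2\sigma f(0)}\qquad\text{and}\qquad \sqrt{\sum_{i=1}^n y_{i-1}^2}\;(\hat\rho_{\rm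 LAD}-\rho_n)\to_d\mathscr N\Big(0,\frac1{4f(0)^2}\Big),$$ where $\to_d$ denotes convergence in distribution, $\mathcal C$ is a standard Cauchy random variable and $\mathscr N(0,v)$ is the centred normal law with variance $v$. -/

import Mathlib

open MeasureTheory ProbabilityTheory Filter Topology

/-- `m` is a median of the real random variable `X`. -/
def IsMedian {Ω : Type*} [MeasurableSpace Ω] (P : Measure Ω) (X : Ω → ℝ) (m : ℝ) : Prop :=
  1 / 2 ≤ P.real {ω | X ω ≤ m} ∧ 1 / 2 ≤ P.real {ω | m ≤ X ω}

/-- `f` is a probability density function (with respect to Lebesgue measure) of `X`. -/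
def IsDensityOf {Ω : Type*} [MeasurableSpace Ω] (P : Measure Ω) (X : Ω → ℝ) (f : ℝ → ℝ) : Prop :=
  (∀ x, 0 ≤ f x) ∧ HasLaw X (volume.withDensity fun x => ENNReal.ofReal (f x)) P

/-- The noise assumptions: `(ε i)`, `i ∈ ℤ`, is an i.i.d. sequence with mean zero, finite variance
`σ ^ 2` and median zero, whose common law has a differentiable density `f` with `f 0 > 0` and
bounded derivative. -/
structure NoiseAssumptions {Ω : Type*} [MeasurableSpace Ω] (P : Measure Ω)
    (ε : ℤ → Ω → ℝ) (σ : ℝ) (f : ℝ → ℝ) : Prop where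
  indep : iIndepFun ε P
  identDistrib : ∀ i, IdentDistrib (ε i) (ε 1) P P
  memLp_two : MemLp (ε 1) 2 P
  mean_zero : ∫ ω, ε 1 ω ∂P = 0
  sigma_nonneg : 0 ≤ σ
  variance_eq : Var[ε 1; P] = σ ^ 2
  median_zero : IsMedian P (ε 1) 0
  density : IsDensityOf P (ε 1) f
  differentiable : Differentiable ℝ f
  density_zero_pos : 0 < f 0
  deriv_bounded : BddAbove (Set.range fun x => |deriv f x|)

/-- The stationary initial value `∑_{j ≥ 0} r ^ j * ε (-j)`. For i.i.d. integrable noise and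
`0 < r < 1` the series converges absolutely almost surely, see `stationaryInit_hasSum`. -/
noncomputable def stationaryInit {Ω : Type*} (ε : ℤ → Ω → ℝ) (r : ℝ) (ω : Ω) : ℝ :=
  ∑' j : ℕ, r ^ j * ε (-(j : ℤ)) ω

theorem stationaryInit_hasSum {Ω : Type*} [MeasurableSpace Ω] {P : Measure Ω}
    {ε : ℤ → Ω → ℝ} (hid : ∀ i, IdentDistrib (ε i) (ε 1) P P) (hint : Integrable (ε 1) P)
    {r : ℝ} (h0 : 0 < r) (h1 : r < 1) :
    ∀ᵐ ω ∂P, HasSum (fun j : ℕ => r ^ j * ε (-(j : ℤ)) ω) (stationaryInit ε r ω) := by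
  have hm : ∀ j : ℕ, AEMeasurable (fun ω => ‖r ^ j * ε (-(j : ℤ)) ω‖ₑ) P := fun j =>
    ((hid _).aemeasurable_fst.const_mul _).enorm
  have hfin : ∫⁻ ω, ∑' j : ℕ, ‖r ^ j * ε (-(j : ℤ)) ω‖ₑ ∂P ≠ ⊤ := by
    rw [lintegral_tsum hm]
    have h : ∀ j : ℕ, ∫⁻ ω, ‖r ^ j * ε (-(j : ℤ)) ω‖ₑ ∂P
        = ‖r‖ₑ ^ j * ∫⁻ ω, ‖ε 1 ω‖ₑ ∂P := by
      intro j
      simp only [enorm_mul, enorm_pow]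
      rw [lintegral_const_mul'' _ (hid _).aemeasurable_fst.enorm]
      congr 1
      exact ((hid (-(j : ℤ))).comp measurable_enorm).lintegral_eq
    simp only [h]
    rw [ENNReal.tsum_mul_right, ENNReal.tsum_geometric]
    refine ENNReal.mul_ne_top (ENNReal.inv_ne_top.2 (tsub_pos_of_lt ?_).ne') hint.2.ne
    rw [Real.enorm_eq_ofReal h0.le]
    exact ENNReal.ofReal_lt_one.2 h1
  filter_upwards [ae_lt_top' (AEMeasurable.tsum hm) hfin] with ω hω
  refine Summable.hasSum (Summable.of_norm ?_)
  have := ENNReal.summable_toReal hω.ne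
  simpa using this

/-- The data generated by the model `y_i = r * y_{i-1} + ε_i`, `i ≥ 1`, started from the stationary
initial value `y_0 = ∑_{j ≥ 0} r ^ j * ε (-j)`. -/
noncomputable def arProcess {Ω : Type*} (ε : ℤ → Ω → ℝ) (r : ℝ) : ℕ → Ω → ℝ
  | 0 => stationaryInit ε r
  | i + 1 => fun ω => r * arProcess ε r i ω + ε ((i : ℤ) + 1) ω

/-- The least absolute deviation objective `(1 / n) * ∑_{i=1}^n |y_i - r * y_{i-1}|`. -/
noncomputable def ladObjective (n : ℕ) (y : ℕ → ℝ) (r : ℝ) : ℝ :=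
  1 / (n : ℝ) * ∑ i ∈ Finset.Icc 1 n, |y i - r * y (i - 1)|

/-- `r` is a least absolute deviation estimate computed from the data `y_0, …, y_n`: a global
minimiser over `ℝ` of the least absolute deviation objective (it need not be unique). -/
def IsLADEstimate (n : ℕ) (y : ℕ → ℝ) (r : ℝ) : Prop :=
  ∀ r' : ℝ, ladObjective n y r ≤ ladObjective n y r'

/-! Since `n(1 - ρ_n) → 0`, the initial value `y_0`, of standard deviation `σ/√(1 - ρ_n²)`, dwarfs
the noise of order `√n` accumulated over the sample. Away from the event that `y_0` is atypically
small, `y_i / y_0 = 1 + x_i`, where `x_i` tends to zero in mean square uniformly in `i ≤ n`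
(`integral_stdDeviation_sq_le`). Substituting `ρ = ρ_n + v/(√n y_0)` turns the criterion, up to the
factor `1/n`, into `∑ |ε_{i+1} - (v/√n)(1 + x_i)|`, nearly the problem defining a sample median.

Less its value at `v = 0`, this sum is `f(0) v² - v S + o_P(1)` for each fixed `v`, with `S =
n^{-1/2} ∑ sign ε_{i+1}` (`measureReal_criterion_sub_quadratic_le`). The linear term is the first
order expansion of `|e - a|` in `a`; the quadratic one is the mean of the remainder, which only sees
the density near zero. By convexity, closeness on a finite grid already locates the minimiser
(`ConvexOn.abs_minimizer_sub_le`), so `√n y_0 (ρ̂ - ρ_n) = S/(2 f(0)) + o_P(1)`.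

Let `Y = √(1 - ρ_n²) y_0 / σ`. The variables `S` and `Y` depend on noise with positive and
nonpositive indices respectively, hence are independent, and both are asymptotically standard
normal; for `Y` this is `tendstoInDistribution_weighted_tsum`. The first statistic is close to `S /
(2 σ f(0) Y)`, and a ratio of independent standard normals is Cauchy. In the second, `√(∑ y_{i-1}²)`
is close to `√n |y_0|`, which leaves `sign(Y) S / (2 f(0))`; an independent random sign does not
alter the centred normal law. -/

/-! ### Tools for convergence in distribution -/

/-- The limit in distribution may be replaced by any random variable with the same law. -/
theorem TendstoInDistribution.congr_law {ι Ω Ω' Ω'' E : Type*} [MeasurableSpace Ω]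
    [MeasurableSpace Ω'] [MeasurableSpace Ω''] {P : Measure Ω} [IsProbabilityMeasure P]
    {μ : Measure Ω'} [IsProbabilityMeasure μ] {ν : Measure Ω''} [IsProbabilityMeasure ν]
    [TopologicalSpace E] [MeasurableSpace E] [OpensMeasurableSpace E]
    {X : ι → Ω → E} {l : Filter ι} {Z : Ω' → E} {W : Ω'' → E}
    (h : TendstoInDistribution X l Z (fun _ => P) μ) (hW : AEMeasurable W ν)
    (hZW : μ.map Z = ν.map W) : TendstoInDistribution X l W (fun _ => P) ν := by
  refine ⟨h.forall_aemeasurable, hW, ?_⟩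
  have h1 := h.tendsto
  simp only [hZW] at h1
  exact h1

/-- **Mapping theorem** for maps that are continuous almost everywhere for the limit law. -/
theorem TendstoInDistribution.comp_of_ae_continuousAt {ι Ω Ω' E F : Type*} [MeasurableSpace Ω]
    [MeasurableSpace Ω'] {P : Measure Ω} [IsProbabilityMeasure P]
    {μ : Measure Ω'} [IsProbabilityMeasure μ]
    [TopologicalSpace E] [MeasurableSpace E] [OpensMeasurableSpace E] [HasOuterApproxClosed E]
    [TopologicalSpace F] [MeasurableSpace F] [OpensMeasurableSpace F]
    {X : ι → Ω → E} {l : Filter ι} [l.IsCountablyGenerated] {Z : Ω' → E} {g : E → F}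
    (h : TendstoInDistribution X l Z (fun _ => P) μ) (hg : Measurable g)
    (hc : ∀ᵐ x ∂(μ.map Z), ContinuousAt g x) :
    TendstoInDistribution (fun n => g ∘ X n) l (g ∘ Z) (fun _ => P) μ := by
  have hX := h.forall_aemeasurable
  have hZ := h.aemeasurable_limit
  refine ⟨fun n => hg.comp_aemeasurable (hX n), hg.comp_aemeasurable hZ, ?_⟩
  refine tendsto_of_forall_isOpen_le_liminf' fun G hG => ?_
  -- The preimage of `G` need not be open, but almost every point of it is interior, so the
  -- portmanteau bound for the interior loses nothing in the limit law.
  have h1 := ProbabilityMeasure.le_liminf_measure_open_of_tendsto h.tendsto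
    (isOpen_interior (s := g ⁻¹' G))
  simp only [ProbabilityMeasure.coe_mk] at h1 ⊢
  calc μ.map (g ∘ Z) G = μ.map Z (g ⁻¹' G) := by
        rw [← AEMeasurable.map_map_of_aemeasurable hg.aemeasurable hZ,
          Measure.map_apply hg hG.measurableSet]
    _ ≤ μ.map Z (interior (g ⁻¹' G)) := by
        refine measure_mono_ae ?_
        filter_upwards [hc] with x hx hxG
        exact mem_interior_iff_mem_nhds.2 (hx.preimage_mem_nhds (hG.mem_nhds hxG))
    _ ≤ l.liminf fun i => P.map (X i) (interior (g ⁻¹' G)) := h1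
    _ ≤ l.liminf fun i => P.map (g ∘ X i) G := by
        refine liminf_le_liminf (Eventually.of_forall fun i => ?_)
        show P.map (X i) _ ≤ _
        rw [← AEMeasurable.map_map_of_aemeasurable hg.aemeasurable (hX i),
          Measure.map_apply hg hG.measurableSet]
        exact measure_mono interior_subset

/-- Convergence in distribution of two independent sequences is joint, with independent limits. -/
theorem TendstoInDistribution.prodMk_of_indepFun {ι Ω E F : Type*} [MeasurableSpace Ω]
    {P : Measure Ω} [IsProbabilityMeasure P]
    [TopologicalSpace E] [SecondCountableTopology E] [TopologicalSpace.PseudoMetrizableSpace E]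
    [MeasurableSpace E] [BorelSpace E]
    [TopologicalSpace F] [SecondCountableTopology F] [TopologicalSpace.PseudoMetrizableSpace F]
    [MeasurableSpace F] [BorelSpace F]
    {μ : Measure E} [IsProbabilityMeasure μ] {ν : Measure F} [IsProbabilityMeasure ν]
    {X : ι → Ω → E} {Y : ι → Ω → F} {l : Filter ι}
    (hX : TendstoInDistribution X l id (fun _ => P) μ)
    (hY : TendstoInDistribution Y l id (fun _ => P) ν)
    (hXY : ∀ n, IndepFun (X n) (Y n) P) :
    TendstoInDistribution (fun n ω => (X n ω, Y n ω)) l id (fun _ => P) (μ.prod ν) := by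
  refine ⟨fun n => (hX.forall_aemeasurable n).prodMk (hY.forall_aemeasurable n),
    aemeasurable_id, ?_⟩
  have h1 := ((ProbabilityMeasure.continuous_prod (α := E) (β := F)).tendsto _).comp
    (hX.tendsto.prodMk_nhds hY.tendsto)
  simp only [Measure.map_id] at h1 ⊢
  refine h1.congr fun n => Subtype.ext ?_
  exact ((indepFun_iff_map_prod_eq_prod_map_map (hX.forall_aemeasurable n)
    (hY.forall_aemeasurable n)).1 (hXY n)).symm

/-! ### Laws of functions of two independent standard normals -/

/-- A law on a product can be computed by conditioning on the second coordinate. -/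
theorem map_prod_apply_eq_lintegral {E F G : Type*} [MeasurableSpace E] [MeasurableSpace F]
    [MeasurableSpace G] (μ : Measure E) (ν : Measure F) [SFinite μ] [SFinite ν] {g : E × F → G}
    (hg : Measurable g) {A : Set G} (hA : MeasurableSet A) :
    (μ.prod ν).map g A = ∫⁻ y, μ.map (fun x => g (x, y)) A ∂ν := by
  rw [Measure.map_apply hg hA, Measure.prod_apply_symm (hg hA)]
  refine lintegral_congr fun y => ?_
  rw [Measure.map_apply (by fun_prop) hA]
  rfl

/-- A standard normal variable with an independent random sign is standard normal. -/
theorem map_sign_mul_gaussianReal_prod :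
    ((gaussianReal 0 1).prod (gaussianReal 0 1)).map (fun p : ℝ × ℝ => Real.sign p.2 * p.1) =
      gaussianReal 0 1 := by
  have hs : Measurable Real.sign :=
    Measurable.ite measurableSet_Iio measurable_const
      (Measurable.ite measurableSet_Ioi measurable_const measurable_const)
  ext A hA
  rw [map_prod_apply_eq_lintegral _ _ (by fun_prop) hA]
  have h0 : ∀ᵐ y ∂(gaussianReal 0 1), y ≠ 0 := by
    have := nullSingletonClass_gaussianReal (μ := 0) (v := 1) one_ne_zero
    simp [ae_iff]
  have : ∀ᵐ y ∂(gaussianReal 0 1),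
      (gaussianReal 0 1).map (fun x => Real.sign y * x) A = gaussianReal 0 1 A := by
    filter_upwards [h0] with y hy
    rw [gaussianReal_map_const_mul]
    congr 2
    · simp
    · ext
      rcases Real.sign_apply_eq_of_ne_zero y hy with h | h <;> simp [h]
  rw [lintegral_congr_ae this]
  simp

theorem lintegral_abs_mul_exp_neg_mul_sq {b : ℝ} (hb : 0 < b) :
    ∫⁻ y : ℝ, ENNReal.ofReal (|y| * Real.exp (-b * y ^ 2)) = ENNReal.ofReal b⁻¹ := by
  have hi : Integrable fun y : ℝ => |y| * Real.exp (-b * y ^ 2) := by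
    refine (integrable_mul_exp_neg_mul_sq hb).abs.congr (Eventually.of_forall fun y => ?_)
    simp [abs_mul]
  rw [← ofReal_integral_eq_lintegral_ofReal hi (Eventually.of_forall fun y => by positivity)]
  congr 1
  have h1 := integral_comp_abs (f := fun y : ℝ => y * Real.exp (-b * y ^ 2))
  simp only [sq_abs] at h1
  rw [h1]
  have h2 := integral_rpow_mul_exp_neg_mul_rpow (p := 2) (q := 1) (b := b) (by norm_num)
    (by norm_num) hb
  norm_num at h2
  norm_num
  rw [h2, Real.rpow_neg_one]
  ring

theorem cauchyMeasure_zero_one :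
    cauchyMeasure 0 1 = volume.withDensity fun c : ℝ => ENNReal.ofReal (Real.pi⁻¹ * (c ^ 2 + 1)⁻¹) := by
  rw [cauchyMeasure_of_scale_ne_zero 0 one_ne_zero]
  congr 1
  ext c
  simp [cauchyPDF_def, cauchyPDFReal_def]

/-- The ratio of two independent standard normal variables has the standard Cauchy law. -/
theorem map_div_gaussianReal_prod :
    ((gaussianReal 0 1).prod (gaussianReal 0 1)).map (fun p : ℝ × ℝ => p.1 / p.2) =
      cauchyMeasure 0 1 := by
  ext A hA
  rw [map_prod_apply_eq_lintegral _ _ (by fun_prop) hA]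
  have h0 : ∀ᵐ y ∂(gaussianReal 0 1), y ≠ 0 := by
    have := nullSingletonClass_gaussianReal (μ := 0) (v := 1) one_ne_zero
    simp [ae_iff]
  have hm : Measurable fun p : ℝ × ℝ => ENNReal.ofReal ((2 * Real.pi)⁻¹ *
      (|p.1| * Real.exp (-((p.2 ^ 2 + 1) / 2) * p.1 ^ 2))) := by fun_prop
  -- Given the denominator `y`, the ratio is normal with variance `1 / y ^ 2`. Mixing these
  -- densities over `y` and exchanging the integrals leaves `∫ |y| exp(-b y²)` with `b = (c² +
  -- 1)/2`, which yields the Cauchy density at `c`.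
  have h1 : ∀ᵐ y ∂(gaussianReal 0 1), (gaussianReal 0 1).map (fun x => x / y) A =
      ∫⁻ c in A, ENNReal.ofReal ((√(2 * Real.pi))⁻¹ * (|y| * Real.exp (-(c ^ 2 / 2) * y ^ 2))) := by
    filter_upwards [h0] with y hy
    rw [gaussianReal_map_div_const, gaussianReal_apply _ (by
      simpa [← NNReal.coe_ne_zero] using hy)]
    refine lintegral_congr fun c => ?_
    rw [gaussianPDF_def]
    simp only [gaussianPDFReal_def]
    congr 1
    have e1 : √(2 * Real.pi * (y ^ 2)⁻¹) = √(2 * Real.pi) * |y|⁻¹ := by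
      rw [Real.sqrt_mul (by positivity), Real.sqrt_inv, Real.sqrt_sq_eq_abs]
    simp [e1]
    rw [mul_comm |y|, mul_assoc]
    have e2 : -c ^ 2 / (2 * (y ^ 2)⁻¹) = -(c ^ 2 / 2 * y ^ 2) := by field_simp
    rw [e2]
  rw [lintegral_congr_ae h1, gaussianReal_of_var_ne_zero _ one_ne_zero,
    lintegral_withDensity_eq_lintegral_mul _ (measurable_gaussianPDF 0 1)
      (Measurable.lintegral_prod_right' (f := fun p : ℝ × ℝ => ENNReal.ofReal
        ((√(2 * Real.pi))⁻¹ * (|p.1| * Real.exp (-(p.2 ^ 2 / 2) * p.1 ^ 2)))) (by fun_prop))]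
  have h2 : ∀ y : ℝ, (gaussianPDF 0 1 * fun y : ℝ => ∫⁻ c in A, ENNReal.ofReal
      ((√(2 * Real.pi))⁻¹ * (|y| * Real.exp (-(c ^ 2 / 2) * y ^ 2)))) y =
      ∫⁻ c in A, ENNReal.ofReal ((2 * Real.pi)⁻¹ *
        (|y| * Real.exp (-((c ^ 2 + 1) / 2) * y ^ 2))) := by
    intro y
    rw [Pi.mul_apply, ← lintegral_const_mul _ (by fun_prop)]
    refine lintegral_congr fun c => ?_
    rw [gaussianPDF_def, ← ENNReal.ofReal_mul (gaussianPDFReal_nonneg _ _ _)]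
    congr 1
    have e1 : (2 * Real.pi)⁻¹ = (√(2 * Real.pi))⁻¹ * (√(2 * Real.pi))⁻¹ := by
      rw [← mul_inv, Real.mul_self_sqrt (by positivity)]
    have e2 : Real.exp (-((c ^ 2 + 1) / 2) * y ^ 2) =
        Real.exp (-(c ^ 2 / 2) * y ^ 2) * Real.exp (-y ^ 2 / 2) := by
      rw [← Real.exp_add]
      ring_nf
    rw [e1, e2]
    simp [gaussianPDFReal_def]
    ring
  simp only [h2]
  rw [lintegral_lintegral_swap hm.aemeasurable, cauchyMeasure_zero_one, withDensity_apply _ hA]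
  refine lintegral_congr fun c => ?_
  have h3 : ∀ y : ℝ, ENNReal.ofReal ((2 * Real.pi)⁻¹ *
      (|y| * Real.exp (-((c ^ 2 + 1) / 2) * y ^ 2))) = ENNReal.ofReal ((2 * Real.pi)⁻¹) *
      ENNReal.ofReal (|y| * Real.exp (-((c ^ 2 + 1) / 2) * y ^ 2)) := fun y =>
    ENNReal.ofReal_mul (by positivity)
  simp only [h3]
  rw [lintegral_const_mul _ (by fun_prop), lintegral_abs_mul_exp_neg_mul_sq (by positivity),
    ← ENNReal.ofReal_mul (by positivity)]
  congr 1
  field_simp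

/-! ### Central limit theorem for weighted infinite sums -/

/-- Replacing the factors one at a time costs at most the difference of the replaced factors, as all
the others lie in the unit disc. This reduces the comparison of characteristic functions to single
summands. -/
theorem Finset.norm_prod_sub_prod_le {ι : Type*} (s : Finset ι) {a b : ι → ℂ}
    (ha : ∀ i, ‖a i‖ ≤ 1) (hb : ∀ i, ‖b i‖ ≤ 1) :
    ‖∏ i ∈ s, a i - ∏ i ∈ s, b i‖ ≤ ∑ i ∈ s, ‖a i - b i‖ := by
  classical
  induction s using Finset.induction_on with
  | empty => simp
  | insert j s hj ih =>
    rw [Finset.prod_insert hj, Finset.prod_insert hj, Finset.sum_insert hj]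
    have e : a j * ∏ i ∈ s, a i - b j * ∏ i ∈ s, b i =
        (a j - b j) * ∏ i ∈ s, a i + b j * (∏ i ∈ s, a i - ∏ i ∈ s, b i) := by ring
    have h1 : ‖∏ i ∈ s, a i‖ ≤ 1 := by
      rw [norm_prod]
      exact Finset.prod_le_one (fun i _ => norm_nonneg _) fun i _ => ha i
    rw [e]
    refine (norm_add_le _ _).trans (add_le_add ?_ ?_)
    · rw [norm_mul]
      exact mul_le_of_le_one_right (norm_nonneg _) h1
    · rw [norm_mul]
      exact (mul_le_of_le_one_left (norm_nonneg _) (hb j)).trans ih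

/-- Near the origin the characteristic function of a standardised law agrees with the standard
normal one up to `o(t ^ 2)`. -/
theorem charFun_sub_exp_isLittleO {Ω : Type*} [MeasurableSpace Ω] {P : Measure Ω}
    [IsProbabilityMeasure P] {X : Ω → ℝ} (hX : AEMeasurable X P) (h0 : P[X] = 0)
    (h1 : P[X ^ 2] = 1) :
    (fun t : ℝ => charFun (P.map X) t - Complex.exp (-t ^ 2 / 2)) =o[𝓝 0] fun t : ℝ => t ^ 2 := by
  have hg : (gaussianReal 0 1)[(id : ℝ → ℝ) ^ 2] = 1 := by
    have := variance_id_gaussianReal (μ := 0) (v := 1)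
    rw [variance_eq_sub (memLp_id_gaussianReal 2)] at this
    simpa using this
  have h2 := taylor_charFun_two (P := gaussianReal 0 1) (X := id) aemeasurable_id (by simp) hg
  have h3 := (taylor_charFun_two hX h0 h1).sub h2
  refine h3.congr_left fun t => ?_
  rw [Measure.map_id, charFun_gaussianReal]
  simp
  ring_nf

/-- A central limit theorem for weighted infinite sums of i.i.d. standardised variables, whose
squared weights sum to one and are uniformly small. -/
theorem tendstoInDistribution_weighted_tsum {Ω : Type*} [MeasurableSpace Ω] {P : Measure Ω}
    [IsProbabilityMeasure P] {X : ℕ → Ω → ℝ} (hindep : iIndepFun X P)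
    (hident : ∀ i, IdentDistrib (X i) (X 0) P P) (h0 : P[X 0] = 0) (h1 : P[X 0 ^ 2] = 1)
    {w : ℕ → ℕ → ℝ} {b : ℕ → ℝ} {Y : ℕ → Ω → ℝ} (hY : ∀ n, AEMeasurable (Y n) P)
    (hsum : ∀ᶠ n in atTop, ∀ᵐ ω ∂P, HasSum (fun j => w n j * X j ω) (Y n ω))
    (hw : ∀ᶠ n in atTop, HasSum (fun j => w n j ^ 2) 1)
    (hwb : ∀ᶠ n in atTop, ∀ j, |w n j| ≤ b n) (hb : Tendsto b atTop (𝓝 0)) :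
    TendstoInDistribution Y atTop id (fun _ => P) (gaussianReal 0 1) := by
  have mX n := (hident n).aemeasurable_fst
  refine ⟨hY, aemeasurable_id, ?_⟩
  refine ProbabilityMeasure.tendsto_iff_tendsto_charFun.2 fun t => ?_
  simp only [ProbabilityMeasure.coe_mk, Measure.map_id, charFun_gaussianReal]
  set φ := charFun (P.map (X 0)) with hφ
  have hPX : IsProbabilityMeasure (P.map (X 0)) := Measure.isProbabilityMeasure_map (mX 0)
  have hlim : Complex.exp (t * (0 : ℝ) * Complex.I - (1 : NNReal) * t ^ 2 / 2) =
      Complex.exp (-t ^ 2 / 2) := by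
    congr 1
    simp
    ring
  rw [hlim, Metric.tendsto_nhds]
  intro δ hδ
  -- The accumulated error will be `c * t ^ 2 * ∑ w_j ^ 2 = c * t ^ 2`, the squared weights summing
  -- to one.
  obtain ⟨c, hc, hct⟩ : ∃ c : ℝ, 0 < c ∧ c * t ^ 2 < δ := by
    refine ⟨δ / (2 * (t ^ 2 + 1)), by positivity, ?_⟩
    rw [div_mul_eq_mul_div, div_lt_iff₀ (by positivity)]
    nlinarith [sq_nonneg t]
  have hsmall := (charFun_sub_exp_isLittleO (mX 0) h0 h1).def hc
  obtain ⟨r, hr, hsmall⟩ := Metric.eventually_nhds_iff.1 hsmall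
  have hbt : ∀ᶠ n in atTop, b n * |t| < r := by
    have : Tendsto (fun n => b n * |t|) atTop (𝓝 0) := by simpa using hb.mul_const |t|
    exact this.eventually_lt_const hr
  filter_upwards [hsum, hw, hwb, hbt] with n hsum hw hwb hbt
  refine lt_of_le_of_lt ?_ hct
  -- Uniform smallness of the weights places every argument `w n j * t` within the radius where the
  -- second order expansion holds; it plays the role of the Lindeberg condition.
  have hterm : ∀ j, ‖φ (w n j * t) - Complex.exp (-((w n j * t : ℝ) : ℂ) ^ 2 / 2)‖ ≤
      c * t ^ 2 * w n j ^ 2 := by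
    intro j
    have hj : dist (w n j * t) 0 < r := by
      rw [dist_zero_right, norm_mul]
      exact (mul_le_mul_of_nonneg_right (hwb j) (abs_nonneg t)).trans_lt hbt
    refine (hsmall hj).trans (le_of_eq ?_)
    rw [Real.norm_of_nonneg (sq_nonneg _)]
    ring
  have hprodφ : Tendsto (fun J => ∏ j ∈ Finset.range J, φ (w n j * t)) atTop
      (𝓝 (charFun (P.map (Y n)) t)) := by
    have h2 : TendstoInDistribution (fun J ω => ∑ j ∈ Finset.range J, w n j * X j ω) atTop (Y n)
        (fun _ => P) P :=
      tendstoInDistribution_of_ae_tendsto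
        (fun J => Finset.aemeasurable_fun_sum _ fun j _ => (mX j).const_mul _) (hY n)
        (hsum.mono fun ω hω => hω.tendsto_sum_nat)
    have h3 := (ProbabilityMeasure.tendsto_iff_tendsto_charFun.1 h2.tendsto) t
    simp only [ProbabilityMeasure.coe_mk] at h3
    refine h3.congr fun J => ?_
    have hi : iIndepFun (fun j ω => w n j * X j ω) P :=
      hindep.comp (fun j x => w n j * x) fun j => by fun_prop
    have h4 := (hi.restrict (Finset.range J)).charFun_map_fun_finsetSum_eq_prod
      (fun j _ => (mX j).const_mul (w n j))
    rw [h4]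
    simp only [Finset.prod_apply]
    refine Finset.prod_congr rfl fun j _ => ?_
    rw [charFun_map_mul_comp (mX j), (hident j).map_eq]
  have hprode : Tendsto (fun J => ∏ j ∈ Finset.range J,
      Complex.exp (-((w n j * t : ℝ) : ℂ) ^ 2 / 2)) atTop (𝓝 (Complex.exp (-t ^ 2 / 2))) := by
    simp only [← Complex.exp_sum]
    refine (Complex.continuous_exp.tendsto _).comp ?_
    have h2 : Tendsto (fun J => ((-t ^ 2 / 2 * ∑ j ∈ Finset.range J, w n j ^ 2 : ℝ) : ℂ)) atTop
        (𝓝 ((-t ^ 2 / 2 * 1 : ℝ) : ℂ)) :=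
      (Complex.continuous_ofReal.tendsto _).comp (hw.tendsto_sum_nat.const_mul _)
    convert h2 using 2 with J
    · push_cast
      rw [Finset.mul_sum]
      exact Finset.sum_congr rfl fun j _ => by ring
    · push_cast
      ring
  rw [dist_eq_norm]
  -- The bound for partial products does not depend on their length `J`, so it passes to the
  -- infinite sum.
  refine le_of_tendsto (hprodφ.sub hprode).norm (Eventually.of_forall fun J => ?_)
  refine (Finset.norm_prod_sub_prod_le _ (fun j => norm_charFun_le_one _) fun j => ?_).trans ?_
  · rw [Complex.norm_exp, show (-((w n j * t : ℝ) : ℂ) ^ 2 / 2) = ((-(w n j * t) ^ 2 / 2 : ℝ) : ℂ) by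
      push_cast; ring, Complex.ofReal_re, Real.exp_le_one_iff]
    nlinarith [sq_nonneg (w n j * t)]
  · calc _ ≤ ∑ j ∈ Finset.range J, c * t ^ 2 * w n j ^ 2 := Finset.sum_le_sum fun j _ => hterm j
      _ = c * t ^ 2 * ∑ j ∈ Finset.range J, w n j ^ 2 := by rw [Finset.mul_sum]
      _ ≤ c * t ^ 2 * 1 := by
        gcongr
        exact sum_le_hasSum _ (fun j _ => sq_nonneg _) hw
      _ = c * t ^ 2 := mul_one _

/-! ### The remainder of the absolute value -/

theorem Real.measurable_sign : Measurable Real.sign :=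
  Measurable.ite measurableSet_Iio measurable_const
    (Measurable.ite measurableSet_Ioi measurable_const measurable_const)

theorem Real.abs_sign_le_one (e : ℝ) : |Real.sign e| ≤ 1 := by
  rcases Real.sign_apply_eq e with h | h | h <;> simp [h]

/-- The remainder of the first order expansion of `a ↦ |e - a|` at `a = 0`. -/
noncomputable def absRemainder (e a : ℝ) : ℝ := |e - a| - |e| + a * Real.sign e

theorem measurable_absRemainder : Measurable fun p : ℝ × ℝ => absRemainder p.1 p.2 := by
  have := Real.measurable_sign
  unfold absRemainder
  fun_prop

@[simp] theorem absRemainder_zero (e : ℝ) : absRemainder e 0 = 0 := by simp [absRemainder]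

theorem absRemainder_neg_neg (e a : ℝ) : absRemainder (-e) (-a) = absRemainder e a := by
  unfold absRemainder
  rw [Real.sign_neg, abs_neg, show -e - -a = -(e - a) by ring, abs_neg]
  ring

theorem absRemainder_eq_zero {e a : ℝ} (h : |a| < |e|) : absRemainder e a = 0 := by
  unfold absRemainder
  have h1 := abs_lt.1 h
  rcases lt_trichotomy e 0 with he | he | he
  · rw [abs_of_neg he] at h1 ⊢
    rw [Real.sign_of_neg he, abs_of_neg (by linarith)]
    ring
  · simp [he] at h
    linarith [abs_nonneg a]
  · rw [abs_of_pos he] at h1 ⊢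
    rw [Real.sign_of_pos he, abs_of_pos (by linarith)]
    ring

theorem absRemainder_of_pos {e a : ℝ} (he : 0 < e) (hea : e ≤ a) :
    absRemainder e a = 2 * (a - e) := by
  unfold absRemainder
  rw [Real.sign_of_pos he, abs_of_pos he, abs_of_nonpos (by linarith)]
  ring

theorem absRemainder_of_neg {e a : ℝ} (he : e < 0) (ha : 0 ≤ a) : absRemainder e a = 0 := by
  unfold absRemainder
  rw [Real.sign_of_neg he, abs_of_neg he, abs_of_nonpos (by linarith)]
  ring

/-- The remainder is `2`-Lipschitz in `a` and vanishes as soon as `|a| < |e|`. Keeping the indicator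
matters: after integration it contributes the small probability that `e` is near zero. -/
theorem abs_absRemainder_sub_le (e a b : ℝ) :
    |absRemainder e a - absRemainder e b| ≤
      {e : ℝ | |e| ≤ max |a| |b|}.indicator (fun _ => 2 * |a - b|) e := by
  by_cases h : |e| ≤ max |a| |b|
  · rw [Set.indicator_of_mem (by exact h)]
    have e1 : absRemainder e a - absRemainder e b =
        (|e - a| - |e - b|) + (a - b) * Real.sign e := by
      unfold absRemainder
      ring
    rw [e1]
    have h1 : |(|e - a| - |e - b|)| ≤ |a - b| := by
      refine (abs_abs_sub_abs_le_abs_sub _ _).trans (le_of_eq ?_)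
      rw [show e - a - (e - b) = -(a - b) by ring, abs_neg]
    have h2 : |(a - b) * Real.sign e| ≤ |a - b| := by
      rw [abs_mul]
      exact mul_le_of_le_one_right (abs_nonneg _) (Real.abs_sign_le_one e)
    linarith [abs_add_le (|e - a| - |e - b|) ((a - b) * Real.sign e)]
  · rw [Set.indicator_of_notMem (by exact h)]
    push Not at h
    rw [absRemainder_eq_zero ((le_max_left _ _).trans_lt h),
      absRemainder_eq_zero ((le_max_right _ _).trans_lt h)]
    simp

theorem abs_absRemainder_le (e a : ℝ) :
    |absRemainder e a| ≤ {e : ℝ | |e| ≤ |a|}.indicator (fun _ => 2 * |a|) e := by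
  simpa using abs_absRemainder_sub_le e a 0

theorem abs_absRemainder_le' (e a : ℝ) : |absRemainder e a| ≤ 2 * |a| :=
  (abs_absRemainder_le e a).trans (Set.indicator_le_self' (fun _ _ => by positivity) _)

/-- Apart from the null point `e = 0`, the graph is the triangle `2 * (a - e)` over `(0, a]`, of
area `a ^ 2`. -/
theorem intervalIntegral_absRemainder_of_nonneg {a : ℝ} (ha : 0 ≤ a) :
    ∫ e in (-a)..a, absRemainder e a = a ^ 2 := by
  have hm : Measurable fun e => absRemainder e a :=
    measurable_absRemainder.comp (by fun_prop : Measurable fun e : ℝ => (e, a))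
  have hi : ∀ u v : ℝ, IntervalIntegrable (fun e => absRemainder e a) volume u v := fun u v =>
    (intervalIntegrable_const (c := 2 * |a|)).mono_fun hm.aestronglyMeasurable
      (Eventually.of_forall fun e => by
        simpa [abs_mul] using abs_absRemainder_le' e a)
  rw [← intervalIntegral.integral_add_adjacent_intervals (hi (-a) 0) (hi 0 a)]
  have h1 : ∫ e in (-a)..0, absRemainder e a = ∫ e in (-a)..0, (0 : ℝ) := by
    refine intervalIntegral.integral_congr_ae ?_
    filter_upwards [compl_mem_ae_iff.2 (measure_singleton (0 : ℝ))] with e he hmem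
    rw [Set.uIoc_of_le (by linarith)] at hmem
    exact absRemainder_of_neg (lt_of_le_of_ne hmem.2 (by simpa using he)) ha
  have h2 : ∫ e in (0 : ℝ)..a, absRemainder e a = ∫ e in (0 : ℝ)..a, 2 * (a - e) := by
    refine intervalIntegral.integral_congr_ae (Eventually.of_forall fun e hmem => ?_)
    rw [Set.uIoc_of_le ha] at hmem
    exact absRemainder_of_pos hmem.1 hmem.2
  rw [h1, h2, intervalIntegral.integral_const_mul, intervalIntegral.integral_sub (by simp) (by simp)]
  simp
  ring

theorem setIntegral_absRemainder (a : ℝ) :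
    ∫ e in Set.Icc (-|a|) |a|, absRemainder e a = a ^ 2 := by
  rw [integral_Icc_eq_integral_Ioc, ← intervalIntegral.integral_of_le (by linarith [abs_nonneg a])]
  rcases le_total 0 a with ha | ha
  · rw [abs_of_nonneg ha, intervalIntegral_absRemainder_of_nonneg ha]
  · rw [abs_of_nonpos ha]
    have h := intervalIntegral_absRemainder_of_nonneg (a := -a) (by linarith)
    rw [← intervalIntegral.integral_comp_neg]
    simp only [neg_neg] at h
    rw [← neg_sq, ← h]
    have : ∀ e, absRemainder (-e) a = absRemainder e (-a) := fun e => by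
      rw [← absRemainder_neg_neg, neg_neg]
    simp [this]

/-! ### Moments of the remainder under a density Lipschitz at zero -/

section Density

variable {f : ℝ → ℝ} {M : ℝ} {μ : Measure ℝ}

/-- For `a ≤ 1` the density is at most `f 0 + M` on an interval of length `2 * a`; for `a ≥ 1` the
extra `1` in the constant makes the bound exceed one. -/
theorem measureReal_abs_le_of_density [IsProbabilityMeasure μ] (hf0 : ∀ x, 0 ≤ f x)
    (hM : ∀ x, |f x - f 0| ≤ M * |x|)
    (hμ : μ = volume.withDensity fun x => ENNReal.ofReal (f x)) {a : ℝ} (ha : 0 ≤ a) :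
    μ.real {e | |e| ≤ a} ≤ (2 * (f 0 + M) + 1) * a := by
  have hM0 : 0 ≤ M := by simpa using (abs_nonneg _).trans (hM 1)
  have hf00 := hf0 0
  rcases le_total a 1 with ha1 | ha1
  · have hset : {e : ℝ | |e| ≤ a} = Set.Icc (-a) a := by
      ext e
      simp [abs_le]
    have h1 : μ {e | |e| ≤ a} ≤ ENNReal.ofReal ((f 0 + M) * (2 * a)) := by
      rw [hset, hμ, withDensity_apply _ measurableSet_Icc]
      calc ∫⁻ x in Set.Icc (-a) a, ENNReal.ofReal (f x)
          ≤ ∫⁻ _ in Set.Icc (-a) a, ENNReal.ofReal (f 0 + M) := by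
            refine setLIntegral_mono measurable_const fun x hx => ENNReal.ofReal_le_ofReal ?_
            have h2 := (abs_le.1 (hM x)).2
            have h3 : M * |x| ≤ M * 1 :=
              mul_le_mul_of_nonneg_left ((abs_le.2 hx).trans ha1) hM0
            linarith
        _ = ENNReal.ofReal ((f 0 + M) * (2 * a)) := by
            rw [setLIntegral_const, Real.volume_Icc, ← ENNReal.ofReal_mul (by positivity)]
            congr 2
            ring
    calc μ.real {e | |e| ≤ a} ≤ (f 0 + M) * (2 * a) :=
          ENNReal.toReal_le_of_le_ofReal (by positivity) h1
      _ ≤ _ := by nlinarith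
  · calc μ.real {e | |e| ≤ a} ≤ 1 := measureReal_le_one
      _ ≤ _ := by nlinarith [mul_nonneg (add_nonneg hf00 hM0) ha]

theorem integral_abs_absRemainder_sub_le [IsProbabilityMeasure μ] {C : ℝ}
    (hC : ∀ a, 0 ≤ a → μ.real {e | |e| ≤ a} ≤ C * a) (a b : ℝ) :
    ∫ e, |absRemainder e a - absRemainder e b| ∂μ ≤ 2 * |a - b| * (C * max |a| |b|) := by
  have hs : MeasurableSet {e : ℝ | |e| ≤ max |a| |b|} :=
    measurableSet_le (by fun_prop) measurable_const
  calc ∫ e, |absRemainder e a - absRemainder e b| ∂μ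
      ≤ ∫ e, {e : ℝ | |e| ≤ max |a| |b|}.indicator (fun _ => 2 * |a - b|) e ∂μ := by
        refine integral_mono_of_nonneg (Eventually.of_forall fun e => abs_nonneg _)
          ((integrable_const _).indicator hs)
          (Eventually.of_forall fun e => abs_absRemainder_sub_le e a b)
    _ = μ.real {e | |e| ≤ max |a| |b|} * (2 * |a - b|) := by
        rw [integral_indicator_const _ hs, smul_eq_mul]
    _ ≤ (C * max |a| |b|) * (2 * |a - b|) := by
        gcongr
        exact hC _ (le_max_of_le_left (abs_nonneg a))
    _ = _ := by ring

/-- The remainder is at most `2 * |a|` and lives on an event of probability at most `C * |a|`. The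
resulting cubic order is what makes a sum of `n` such terms negligible when `a` is of order `1 /
√n`. -/
theorem integral_absRemainder_sq_le [IsProbabilityMeasure μ] {C : ℝ}
    (hC : ∀ a, 0 ≤ a → μ.real {e | |e| ≤ a} ≤ C * a) (a : ℝ) :
    ∫ e, absRemainder e a ^ 2 ∂μ ≤ 4 * C * |a| ^ 3 := by
  have hs : MeasurableSet {e : ℝ | |e| ≤ |a|} := measurableSet_le (by fun_prop) measurable_const
  calc ∫ e, absRemainder e a ^ 2 ∂μ
      ≤ ∫ e, {e : ℝ | |e| ≤ |a|}.indicator (fun _ => (2 * |a|) ^ 2) e ∂μ := by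
        refine integral_mono_of_nonneg (Eventually.of_forall fun e => sq_nonneg _)
          ((integrable_const _).indicator hs) (Eventually.of_forall fun e => ?_)
        have h := abs_absRemainder_le e a
        by_cases he : |e| ≤ |a|
        · rw [Set.indicator_of_mem (by exact he)] at h ⊢
          exact (sq_abs _).symm.trans_le (pow_le_pow_left₀ (abs_nonneg _) h 2)
        · rw [Set.indicator_of_notMem (by exact he)] at h ⊢
          have := abs_nonpos_iff.1 h
          simp [this]
    _ = μ.real {e | |e| ≤ |a|} * (2 * |a|) ^ 2 := by
        rw [integral_indicator_const _ hs, smul_eq_mul]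
    _ ≤ (C * |a|) * (2 * |a|) ^ 2 := by
        gcongr
        exact hC _ (abs_nonneg a)
    _ = _ := by ring

/-- Freezing the density at `f 0` gives exactly `f 0 * a ^ 2`. The error integrates at most `M *
|a|` times `2 * |a|` over an interval of length `2 * |a|`. -/
theorem abs_integral_absRemainder_sub_le (hfm : Measurable f) (hf0 : ∀ x, 0 ≤ f x)
    (hM : ∀ x, |f x - f 0| ≤ M * |x|)
    (hμ : μ = volume.withDensity fun x => ENNReal.ofReal (f x)) (a : ℝ) :
    |∫ e, absRemainder e a ∂μ - f 0 * a ^ 2| ≤ 4 * M * |a| ^ 3 := by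
  have hM0 : 0 ≤ M := by simpa using (abs_nonneg _).trans (hM 1)
  have hm : Measurable fun e => absRemainder e a :=
    measurable_absRemainder.comp (by fun_prop : Measurable fun e : ℝ => (e, a))
  set I := Set.Icc (-|a|) |a| with hI
  have h1 : ∫ e, absRemainder e a ∂μ = ∫ e in I, f e * absRemainder e a := by
    rw [hμ, integral_withDensity_eq_integral_toReal_smul (by fun_prop)
      (Eventually.of_forall fun _ => ENNReal.ofReal_lt_top),
      ← setIntegral_eq_integral_of_forall_compl_eq_zero (s := I)]
    · simp [ENNReal.toReal_ofReal (hf0 _)]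
    · intro e he
      rw [absRemainder_eq_zero (not_le.1 fun h => he (abs_le.1 h)), smul_zero]
  have hb : ∀ e ∈ I, |(f e - f 0) * absRemainder e a| ≤ M * |a| * (2 * |a|) := fun e he => by
    rw [abs_mul]
    gcongr
    · exact (hM e).trans (mul_le_mul_of_nonneg_left (abs_le.2 he) hM0)
    · exact abs_absRemainder_le' e a
  have hfin : IsFiniteMeasure (volume.restrict I) := ⟨by simp [hI]⟩
  have hi1 : Integrable (fun e => (f e - f 0) * absRemainder e a) (volume.restrict I) := by
    refine Integrable.of_bound (by fun_prop) (M * |a| * (2 * |a|)) ?_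
    exact (ae_restrict_mem measurableSet_Icc).mono hb
  have hi2 : Integrable (fun e => f 0 * absRemainder e a) (volume.restrict I) :=
    (Integrable.of_bound (by fun_prop) (2 * |a|)
      (Eventually.of_forall fun e => abs_absRemainder_le' e a)).const_mul _
  have h2 : ∫ e in I, f e * absRemainder e a =
      (∫ e in I, (f e - f 0) * absRemainder e a) + f 0 * a ^ 2 := by
    rw [← setIntegral_absRemainder a, ← integral_const_mul, ← integral_add hi1 hi2]
    refine integral_congr_ae (Eventually.of_forall fun e => ?_)
    simp only
    ring
  rw [h1, h2, add_sub_cancel_right, ← Real.norm_eq_abs]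
  refine (norm_setIntegral_le_of_norm_le_const (C := M * |a| * (2 * |a|)) (by simp [hI]) hb).trans
    (le_of_eq ?_)
  rw [measureReal_def, hI, Real.volume_Icc, ENNReal.toReal_ofReal (by linarith [abs_nonneg a])]
  ring

end Density

/-! ### Sigma-algebras generated by blocks of the noise -/

section Past

variable {Ω : Type*} [MeasurableSpace Ω] {P : Measure Ω} {ε : ℤ → Ω → ℝ}

/-- The `σ`-algebra generated by the variables `ε k`, `k ∈ S`. -/
abbrev sigmaOf {Ω : Type*} (ε : ℤ → Ω → ℝ) (S : Set ℤ) : MeasurableSpace Ω :=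
  ⨆ k ∈ S, MeasurableSpace.comap (ε k) inferInstance

theorem sigmaOf_le (hε : ∀ k, Measurable (ε k)) (S : Set ℤ) : sigmaOf ε S ≤ ‹MeasurableSpace Ω› :=
  iSup₂_le fun k _ => (hε k).comap_le

theorem sigmaOf_mono {Ω : Type*} (ε : ℤ → Ω → ℝ) {S T : Set ℤ} (h : S ⊆ T) :
    sigmaOf ε S ≤ sigmaOf ε T :=
  biSup_mono h

theorem measurable_sigmaOf {Ω : Type*} (ε : ℤ → Ω → ℝ) {S : Set ℤ} {k : ℤ} (hk : k ∈ S) :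
    Measurable[sigmaOf ε S] (ε k) :=
  (comap_measurable (ε k)).mono
    (le_iSup₂ (f := fun k (_ : k ∈ S) => MeasurableSpace.comap (ε k) inferInstance) k hk) le_rfl

theorem indepFun_of_measurable_sigmaOf (hε : ∀ k, Measurable (ε k)) (hind : iIndepFun ε P)
    {S T : Set ℤ} (hST : Disjoint S T) {E F : Type*} [MeasurableSpace E] [MeasurableSpace F]
    {X : Ω → E} {Y : Ω → F} (hX : Measurable[sigmaOf ε S] X) (hY : Measurable[sigmaOf ε T] Y) :
    IndepFun X Y P := by
  have h := indep_iSup_of_disjoint (fun k => (hε k).comap_le) hind hST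
  exact indep_of_indep_of_le_left (indep_of_indep_of_le_right h hY.comap_le) hX.comap_le

end Past

/-! ### Orthogonal sums and Markov inequalities -/

theorem integral_sum_sq_of_orthogonal {Ω : Type*} [MeasurableSpace Ω] {P : Measure Ω}
    {Z : ℕ → Ω → ℝ} {n : ℕ} (hZ : ∀ i < n, MemLp (Z i) 2 P)
    (ho : ∀ i j, i < j → j < n → ∫ ω, Z i ω * Z j ω ∂P = 0) :
    ∫ ω, (∑ i ∈ Finset.range n, Z i ω) ^ 2 ∂P = ∑ i ∈ Finset.range n, ∫ ω, Z i ω ^ 2 ∂P := by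
  induction n with
  | zero => simp
  | succ n ih =>
    have ih := ih (fun i hi => hZ i (by omega)) (fun i j hij hj => ho i j hij (by omega))
    have hA : MemLp (fun ω => ∑ i ∈ Finset.range n, Z i ω) 2 P :=
      memLp_finsetSum _ fun i hi => hZ i (by have := Finset.mem_range.1 hi; omega)
    have hn := hZ n (by omega)
    have hc : ∫ ω, (∑ i ∈ Finset.range n, Z i ω) * Z n ω ∂P = 0 := by
      simp only [Finset.sum_mul]
      rw [integral_finsetSum]
      · exact Finset.sum_eq_zero fun i hi => ho i n (Finset.mem_range.1 hi) (by omega)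
      · intro i hi
        exact (hZ i (by have := Finset.mem_range.1 hi; omega)).integrable_mul hn
    rw [Finset.sum_range_succ, ← ih]
    have e : ∀ ω, (∑ i ∈ Finset.range (n + 1), Z i ω) ^ 2 =
        ((∑ i ∈ Finset.range n, Z i ω) ^ 2 + 2 * ((∑ i ∈ Finset.range n, Z i ω) * Z n ω)) +
          Z n ω ^ 2 := fun ω => by
      rw [Finset.sum_range_succ]
      ring
    have hAZ : Integrable (fun ω => 2 * ((∑ i ∈ Finset.range n, Z i ω) * Z n ω)) P :=
      (hA.integrable_mul hn).const_mul 2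
    have hAAZ : Integrable (fun ω => (∑ i ∈ Finset.range n, Z i ω) ^ 2 +
        2 * ((∑ i ∈ Finset.range n, Z i ω) * Z n ω)) P := hA.integrable_sq.add hAZ
    simp only [e]
    rw [integral_add hAAZ hn.integrable_sq, integral_add hA.integrable_sq hAZ, integral_const_mul,
      hc]
    ring

theorem measureReal_abs_ge_le_integral_abs {Ω : Type*} [MeasurableSpace Ω] {P : Measure Ω}
    {Z : Ω → ℝ} (hZ : Integrable Z P) {κ : ℝ} (hκ : 0 < κ) :
    P.real {ω | κ ≤ |Z ω|} ≤ (∫ ω, |Z ω| ∂P) / κ := by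
  rw [le_div_iff₀' hκ]
  exact mul_meas_ge_le_integral_of_nonneg (Eventually.of_forall fun ω => abs_nonneg _) hZ.abs κ

theorem measureReal_abs_ge_le_integral_sq {Ω : Type*} [MeasurableSpace Ω] {P : Measure Ω}
    {Z : Ω → ℝ} (hZ : MemLp Z 2 P) {κ : ℝ} (hκ : 0 < κ) :
    P.real {ω | κ ≤ |Z ω|} ≤ (∫ ω, Z ω ^ 2 ∂P) / κ ^ 2 := by
  rw [le_div_iff₀' (by positivity)]
  have h := mul_meas_ge_le_integral_of_nonneg (Eventually.of_forall fun ω => sq_nonneg (Z ω))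
    hZ.integrable_sq (κ ^ 2)
  refine le_trans (le_of_eq ?_) h
  congr 2
  ext ω
  simp only [Set.mem_ofPred_eq]
  rw [sq_le_sq, abs_of_pos hκ]

theorem integral_abs_le_sqrt {Ω : Type*} [MeasurableSpace Ω] {P : Measure Ω}
    [IsProbabilityMeasure P] {Z : Ω → ℝ} (hZ : MemLp Z 2 P) :
    ∫ ω, |Z ω| ∂P ≤ √(∫ ω, Z ω ^ 2 ∂P) := by
  refine Real.le_sqrt_of_sq_le ?_
  have h := variance_nonneg (fun ω => |Z ω|) P
  rw [variance_eq_sub (X := fun ω => |Z ω|) hZ.abs] at h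
  simp only [Pi.pow_apply, sq_abs] at h
  linarith

/-! ### Quadratic approximation of the criterion -/

section Core

variable {Ω : Type*} [MeasurableSpace Ω] {P : Measure Ω}
  {ε : ℤ → Ω → ℝ} {μ : Measure ℝ} {x : ℕ → Ω → ℝ} {n : ℕ} {τ C : ℝ}

/-- The summands are martingale differences: `x i` depends on the noise up to time `i`, while the
sign at time `i + 1` is centred and independent of that past. Hence they are orthogonal, and signs
are bounded by one. -/
theorem integral_sum_mul_sign_sq_le (hε : ∀ k, Measurable (ε k)) (hind : iIndepFun ε P)
    (hlaw : ∀ k, P.map (ε k) = μ) (hsgn : ∫ e, Real.sign e ∂μ = 0)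
    (hx : ∀ i : ℕ, Measurable[sigmaOf ε (Set.Iic (i : ℤ))] (x i)) (hx2 : ∀ i < n, MemLp (x i) 2 P)
    (hτ : ∀ i < n, ∫ ω, x i ω ^ 2 ∂P ≤ τ) :
    MemLp (fun ω => ∑ i ∈ Finset.range n, x i ω * Real.sign (ε ((i : ℤ) + 1) ω)) 2 P ∧
    ∫ ω, (∑ i ∈ Finset.range n, x i ω * Real.sign (ε ((i : ℤ) + 1) ω)) ^ 2 ∂P ≤ n * τ := by
  have hsm : ∀ k, Measurable fun ω => Real.sign (ε k ω) := fun k =>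
    Real.measurable_sign.comp (hε k)
  have hle : ∀ i < n, ∀ ω, ‖x i ω * Real.sign (ε ((i : ℤ) + 1) ω)‖ ≤ ‖x i ω‖ := fun i _ ω => by
    rw [norm_mul]
    exact mul_le_of_le_one_right (norm_nonneg _) (Real.abs_sign_le_one _)
  have hxm : ∀ i, Measurable (x i) := fun i => (hx i).mono (sigmaOf_le hε _) le_rfl
  have hZ : ∀ i < n, MemLp (fun ω => x i ω * Real.sign (ε ((i : ℤ) + 1) ω)) 2 P := fun i hi =>
    (hx2 i hi).mono ((hxm i).mul (hsm _)).aestronglyMeasurable (Eventually.of_forall (hle i hi))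
  refine ⟨memLp_finsetSum _ fun i hi => hZ i (Finset.mem_range.1 hi), ?_⟩
  rw [integral_sum_sq_of_orthogonal hZ]
  · calc _ ≤ ∑ i ∈ Finset.range n, τ := by
          refine Finset.sum_le_sum fun i hi => ?_
          have hi := Finset.mem_range.1 hi
          refine le_trans (integral_mono (hZ i hi).integrable_sq (hx2 i hi).integrable_sq ?_)
            (hτ i hi)
          intro ω
          exact sq_le_sq.2 (hle i hi ω)
      _ = n * τ := by simp
  · intro i j hij _
    have hle' : sigmaOf ε (Set.Iic (i : ℤ)) ≤ sigmaOf ε (Set.Iic (j : ℤ)) :=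
      sigmaOf_mono ε (Set.Iic_subset_Iic.2 (by omega))
    have hU : Measurable[sigmaOf ε (Set.Iic (j : ℤ))]
        fun ω => x i ω * Real.sign (ε ((i : ℤ) + 1) ω) * x j ω :=
      (((hx i).mono hle' le_rfl).mul (Real.measurable_sign.comp
        (measurable_sigmaOf ε (S := Set.Iic (j : ℤ)) (k := (i : ℤ) + 1)
          (Set.mem_Iic.2 (by omega))))).mul (hx j)
    have hV : Measurable[sigmaOf ε {(j : ℤ) + 1}] fun ω => Real.sign (ε ((j : ℤ) + 1) ω) :=
      Real.measurable_sign.comp (measurable_sigmaOf ε rfl)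
    have hUV := indepFun_of_measurable_sigmaOf hε hind (by simp) hU hV
    have h0 : ∫ ω, Real.sign (ε ((j : ℤ) + 1) ω) ∂P = 0 := by
      rw [← hsgn, ← hlaw ((j : ℤ) + 1), integral_map (hε _).aemeasurable
        Real.measurable_sign.aestronglyMeasurable]
    have h1 := hUV.integral_fun_mul_eq_mul_integral
      (hU.mono (sigmaOf_le hε _) le_rfl).aestronglyMeasurable (hsm _).aestronglyMeasurable
    rw [h0, mul_zero] at h1
    rw [← h1]
    refine integral_congr_ae (Eventually.of_forall fun ω => ?_)
    simp only
    ring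

/-- The perturbation `x` is independent of the next noise variable, so Fubini allows it to be frozen
at a value `t`. The Lipschitz factor `2 |a| |t|` times the probability `C |a| (1 + |t|)` is of order
`a ^ 2`, hence summable over `n` terms, and it is small with the second moment of `x`. -/
theorem integral_abs_absRemainder_comp_sub_le [IsProbabilityMeasure P] (hε : ∀ k, Measurable (ε k)) (hind : iIndepFun ε P)
    (hlaw : ∀ k, P.map (ε k) = μ)
    (hC : ∀ a, 0 ≤ a → μ.real {e | |e| ≤ a} ≤ C * a)
    {i : ℕ} {x : Ω → ℝ} (hx : Measurable[sigmaOf ε (Set.Iic (i : ℤ))] x) (hx2 : MemLp x 2 P)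
    (hτ : ∫ ω, x ω ^ 2 ∂P ≤ τ) (a : ℝ) :
    Integrable (fun ω => absRemainder (ε ((i : ℤ) + 1) ω) (a * (1 + x ω)) -
      absRemainder (ε ((i : ℤ) + 1) ω) a) P ∧
    ∫ ω, |absRemainder (ε ((i : ℤ) + 1) ω) (a * (1 + x ω)) -
      absRemainder (ε ((i : ℤ) + 1) ω) a| ∂P ≤ 2 * C * a ^ 2 * (√τ + τ) := by
  have hxm : Measurable x := hx.mono (sigmaOf_le hε _) le_rfl
  have hμ : IsProbabilityMeasure μ := by
    rw [← hlaw 0]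
    exact Measure.isProbabilityMeasure_map (hε 0).aemeasurable
  have hC0 : 0 ≤ C := by simpa using measureReal_nonneg.trans (hC 1 zero_le_one)
  set h : ℝ × ℝ → ℝ := fun p => absRemainder p.2 (a * (1 + p.1)) - absRemainder p.2 a with hh
  have hhm : Measurable h := by
    refine Measurable.sub (measurable_absRemainder.comp
      (by fun_prop : Measurable fun p : ℝ × ℝ => (p.2, a * (1 + p.1)))) (measurable_absRemainder.comp
      (by fun_prop : Measurable fun p : ℝ × ℝ => (p.2, a)))
  have hpair : Measurable fun ω => (x ω, ε ((i : ℤ) + 1) ω) := hxm.prodMk (hε _)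
  have hbd : ∀ p, |h p| ≤ 2 * |a| * |p.1| := fun p => by
    refine (abs_absRemainder_sub_le _ _ _).trans
      ((Set.indicator_le_self' (fun _ _ => by positivity) _).trans (le_of_eq ?_))
    rw [show a * (1 + p.1) - a = a * p.1 by ring, abs_mul]
    ring
  have hint : Integrable (fun ω => h (x ω, ε ((i : ℤ) + 1) ω)) P := by
    refine ((hx2.integrable one_le_two).abs.const_mul (2 * |a|)).mono'
      (hhm.comp hpair).aestronglyMeasurable (Eventually.of_forall fun ω => ?_)
    exact hbd _
  refine ⟨hint, ?_⟩
  have hjoint : P.map (fun ω => (x ω, ε ((i : ℤ) + 1) ω)) = (P.map x).prod μ := by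
    rw [← hlaw ((i : ℤ) + 1)]
    exact (indepFun_iff_map_prod_eq_prod_map_map hxm.aemeasurable (hε _).aemeasurable).1
      (indepFun_of_measurable_sigmaOf hε hind (T := {(i : ℤ) + 1}) (by simp) hx
        (measurable_sigmaOf ε rfl))
  have hPx : IsProbabilityMeasure (P.map x) := Measure.isProbabilityMeasure_map hxm.aemeasurable
  have hintp : Integrable (fun p => |h p|) ((P.map x).prod μ) := by
    rw [← hjoint, integrable_map_measure hhm.abs.aestronglyMeasurable hpair.aemeasurable]
    exact hint.abs
  have hbi : Integrable (fun t : ℝ => 2 * C * a ^ 2 * (|t| + t ^ 2)) (P.map x) := by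
    rw [integrable_map_measure (by fun_prop) hxm.aemeasurable]
    exact ((hx2.integrable one_le_two).abs.add hx2.integrable_sq).const_mul _
  calc ∫ ω, |h (x ω, ε ((i : ℤ) + 1) ω)| ∂P
      = ∫ t, ∫ e, |h (t, e)| ∂μ ∂(P.map x) := by
        rw [← integral_prod _ hintp, ← hjoint, integral_map hpair.aemeasurable
          hhm.abs.aestronglyMeasurable]
    _ ≤ ∫ t, 2 * C * a ^ 2 * (|t| + t ^ 2) ∂(P.map x) := by
        refine integral_mono hintp.integral_prod_left hbi fun t => ?_
        refine (integral_abs_absRemainder_sub_le hC (a * (1 + t)) a).trans ?_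
        rw [show a * (1 + t) - a = a * t by ring, abs_mul]
        have h1 : max |a * (1 + t)| |a| ≤ |a| * (1 + |t|) := by
          refine max_le ?_ (le_mul_of_one_le_right (abs_nonneg a) (by simp))
          rw [abs_mul]
          gcongr
          exact (abs_add_le _ _).trans (by simp)
        calc 2 * (|a| * |t|) * (C * max |a * (1 + t)| |a|)
            ≤ 2 * (|a| * |t|) * (C * (|a| * (1 + |t|))) := by gcongr
          _ = 2 * C * |a| ^ 2 * (|t| + |t| ^ 2) := by ring
          _ = _ := by rw [sq_abs, sq_abs]
    _ = 2 * C * a ^ 2 * (∫ ω, |x ω| ∂P + ∫ ω, x ω ^ 2 ∂P) := by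
        rw [integral_map hxm.aemeasurable (by fun_prop), integral_const_mul,
          integral_add (hx2.integrable one_le_two).abs hx2.integrable_sq]
    _ ≤ 2 * C * a ^ 2 * (√τ + τ) := by
        gcongr
        exact (integral_abs_le_sqrt hx2).trans (Real.sqrt_le_sqrt hτ)

/-- Centred independent summands are orthogonal, and each variance is at most the cubic second
moment. -/
theorem integral_sum_absRemainder_sub_sq_le [IsProbabilityMeasure P] (hε : ∀ k, Measurable (ε k)) (hind : iIndepFun ε P)
    (hlaw : ∀ k, P.map (ε k) = μ) (hC : ∀ a, 0 ≤ a → μ.real {e | |e| ≤ a} ≤ C * a) (n : ℕ)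
    (a : ℝ) :
    MemLp (fun ω => ∑ i ∈ Finset.range n, (absRemainder (ε ((i : ℤ) + 1) ω) a -
      ∫ e, absRemainder e a ∂μ)) 2 P ∧
    ∫ ω, (∑ i ∈ Finset.range n, (absRemainder (ε ((i : ℤ) + 1) ω) a -
      ∫ e, absRemainder e a ∂μ)) ^ 2 ∂P ≤ n * (4 * C * |a| ^ 3) := by
  have hμ : IsProbabilityMeasure μ := by
    rw [← hlaw 0]
    exact Measure.isProbabilityMeasure_map (hε 0).aemeasurable
  set m := ∫ e, absRemainder e a ∂μ with hm
  have hgm : Measurable fun e => absRemainder e a :=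
    measurable_absRemainder.comp (by fun_prop : Measurable fun e : ℝ => (e, a))
  have hgk : ∀ k, MemLp (fun ω => absRemainder (ε k ω) a) 2 P := fun k =>
    MemLp.of_bound (hgm.comp (hε k)).aestronglyMeasurable (2 * |a|)
      (Eventually.of_forall fun ω => abs_absRemainder_le' _ a)
  have hmean : ∀ k, ∫ ω, absRemainder (ε k ω) a ∂P = m := fun k => by
    rw [hm, ← hlaw k, integral_map (hε k).aemeasurable hgm.aestronglyMeasurable]
  have hZ : ∀ k, MemLp (fun ω => absRemainder (ε k ω) a - m) 2 P := fun k =>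
    (hgk k).sub (memLp_const m)
  have hmean0 : ∀ k, ∫ ω, (absRemainder (ε k ω) a - m) ∂P = 0 := fun k => by
    rw [integral_sub ((hgk k).integrable one_le_two) (integrable_const m), hmean]
    simp
  refine ⟨memLp_finsetSum _ fun i _ => hZ _, ?_⟩
  rw [integral_sum_sq_of_orthogonal (Z := fun i ω => absRemainder (ε ((i : ℤ) + 1) ω) a - m)
    fun i _ => hZ _]
  · calc _ ≤ ∑ i ∈ Finset.range n, 4 * C * |a| ^ 3 := by
          refine Finset.sum_le_sum fun i _ => ?_
          have h1 := variance_eq_sub (hgk ((i : ℤ) + 1))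
          rw [variance_eq_integral (hgk ((i : ℤ) + 1)).aemeasurable, hmean] at h1
          rw [h1]
          have h2 : ∫ ω, absRemainder (ε ((i : ℤ) + 1) ω) a ^ 2 ∂P =
              ∫ e, absRemainder e a ^ 2 ∂μ := by
            rw [← hlaw ((i : ℤ) + 1), integral_map (hε _).aemeasurable
              (hgm.pow_const 2).aestronglyMeasurable]
          simp only [Pi.pow_apply]
          rw [h2]
          linarith [integral_absRemainder_sq_le hC a, sq_nonneg m]
      _ = _ := by simp
  · intro i j hij _
    have h1 : IndepFun (fun ω => absRemainder (ε ((i : ℤ) + 1) ω) a - m)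
        (fun ω => absRemainder (ε ((j : ℤ) + 1) ω) a - m) P :=
      (hind.indepFun (i := (i : ℤ) + 1) (j := (j : ℤ) + 1) (by omega)).comp
        (hgm.sub_const m) (hgm.sub_const m)
    rw [h1.integral_fun_mul_eq_mul_integral (hZ _).1 (hZ _).1, hmean0, zero_mul]

/-- Quadratic approximation of the centred least absolute deviation criterion. -/
theorem measureReal_criterion_sub_quadratic_le [IsProbabilityMeasure P] {M f₀ : ℝ} (hn : 0 < n)
    (hε : ∀ k, Measurable (ε k)) (hind : iIndepFun ε P)
    (hlaw : ∀ k, P.map (ε k) = μ) (hsgn : ∫ e, Real.sign e ∂μ = 0)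
    (hC : ∀ a, 0 ≤ a → μ.real {e | |e| ≤ a} ≤ C * a)
    (hquad : ∀ a, |∫ e, absRemainder e a ∂μ - f₀ * a ^ 2| ≤ 4 * M * |a| ^ 3)
    (hx : ∀ i : ℕ, Measurable[sigmaOf ε (Set.Iic (i : ℤ))] (x i)) (hx2 : ∀ i < n, MemLp (x i) 2 P)
    (hτ : ∀ i < n, ∫ ω, x i ω ^ 2 ∂P ≤ τ) {v κ : ℝ} (hκ : 0 < κ)
    (hsmall : 4 * M * (|v| ^ 3 / √n) < κ / 4) :
    P.real {ω | κ ≤ |∑ i ∈ Finset.range n, (|ε ((i : ℤ) + 1) ω - v / √n * (1 + x i ω)| -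
        |ε ((i : ℤ) + 1) ω|) + v * ((√n)⁻¹ * ∑ i ∈ Finset.range n, Real.sign (ε ((i : ℤ) + 1) ω)) -
        f₀ * v ^ 2|} ≤
      v ^ 2 * τ / (κ / 4) ^ 2 + 2 * C * v ^ 2 * (√τ + τ) / (κ / 4) +
        4 * C * (|v| ^ 3 / √n) / (κ / 4) ^ 2 := by
  have hκ4 : 0 < κ / 4 := by positivity
  have hsn : 0 < √(n : ℝ) := Real.sqrt_pos.2 (by exact_mod_cast hn)
  have hsq : √(n : ℝ) ^ 2 = n := Real.sq_sqrt (by positivity)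
  set a := v / √n with ha
  have hna : n * a ^ 2 = v ^ 2 := by
    rw [ha, div_pow, hsq]
    field_simp
  have hna3 : n * |a| ^ 3 = |v| ^ 3 / √n := by
    rw [ha, abs_div, abs_of_pos hsn, div_pow]
    nth_rewrite 1 [← hsq]
    field_simp
  set m := ∫ e, absRemainder e a ∂μ with hm
  obtain ⟨hA1, hA1'⟩ := integral_sum_mul_sign_sq_le hε hind hlaw hsgn hx hx2 hτ
  obtain ⟨hA3, hA3'⟩ := integral_sum_absRemainder_sub_sq_le hε hind hlaw hC n a
  have hA2 := fun i hi => integral_abs_absRemainder_comp_sub_le hε hind hlaw hC (hx i) (hx2 i hi)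
    (hτ i hi) a
  set A1 : Ω → ℝ := fun ω => ∑ i ∈ Finset.range n, x i ω * Real.sign (ε ((i : ℤ) + 1) ω) with hA1d
  set A2 : Ω → ℝ := fun ω => ∑ i ∈ Finset.range n,
    (absRemainder (ε ((i : ℤ) + 1) ω) (a * (1 + x i ω)) -
      absRemainder (ε ((i : ℤ) + 1) ω) a) with hA2d
  set A3 : Ω → ℝ := fun ω => ∑ i ∈ Finset.range n,
    (absRemainder (ε ((i : ℤ) + 1) ω) a - m) with hA3d
  have hA2i : Integrable A2 P :=
    integrable_finsetSum _ fun i hi => (hA2 i (Finset.mem_range.1 hi)).1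
  have hA2b : ∫ ω, |A2 ω| ∂P ≤ 2 * C * v ^ 2 * (√τ + τ) := by
    calc ∫ ω, |A2 ω| ∂P ≤ ∫ ω, ∑ i ∈ Finset.range n,
          |absRemainder (ε ((i : ℤ) + 1) ω) (a * (1 + x i ω)) -
            absRemainder (ε ((i : ℤ) + 1) ω) a| ∂P :=
          integral_mono hA2i.abs
            (integrable_finsetSum _ fun i hi => (hA2 i (Finset.mem_range.1 hi)).1.abs)
            fun ω => Finset.abs_sum_le_sum_abs _ _
      _ = ∑ i ∈ Finset.range n, ∫ ω, |absRemainder (ε ((i : ℤ) + 1) ω) (a * (1 + x i ω)) -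
            absRemainder (ε ((i : ℤ) + 1) ω) a| ∂P :=
          integral_finsetSum _ fun i hi => (hA2 i (Finset.mem_range.1 hi)).1.abs
      _ ≤ ∑ i ∈ Finset.range n, 2 * C * a ^ 2 * (√τ + τ) :=
          Finset.sum_le_sum fun i hi => (hA2 i (Finset.mem_range.1 hi)).2
      _ = 2 * C * v ^ 2 * (√τ + τ) := by
          rw [← hna]
          simp
          ring
  have hA4 : |n * m - f₀ * v ^ 2| < κ / 4 := by
    refine lt_of_le_of_lt ?_ hsmall
    rw [← hna, ← hna3, show n * m - f₀ * (n * a ^ 2) = n * (m - f₀ * a ^ 2) by ring, abs_mul,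
      Nat.abs_cast]
    calc (n : ℝ) * |m - f₀ * a ^ 2| ≤ n * (4 * M * |a| ^ 3) := by
          gcongr
          exact hquad a
      _ = _ := by ring
  -- Four errors: the effect of `x` on the linear term, its effect on the remainder, the fluctuation
  -- of the unperturbed remainder, and the bias of its mean. The last is deterministic and below `κ
  -- / 4` by `hA4`, so one of the other three must reach `κ / 4`.
  have hdecomp : ∀ ω, ∑ i ∈ Finset.range n, (|ε ((i : ℤ) + 1) ω - a * (1 + x i ω)| -
        |ε ((i : ℤ) + 1) ω|) + v * ((√n)⁻¹ * ∑ i ∈ Finset.range n, Real.sign (ε ((i : ℤ) + 1) ω)) -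
        f₀ * v ^ 2 = -(a * A1 ω) + A2 ω + A3 ω + (n * m - f₀ * v ^ 2) := by
    intro ω
    have e1 : v * ((√n)⁻¹ * ∑ i ∈ Finset.range n, Real.sign (ε ((i : ℤ) + 1) ω)) =
        ∑ i ∈ Finset.range n, a * Real.sign (ε ((i : ℤ) + 1) ω) := by
      rw [← mul_assoc, ← div_eq_mul_inv, Finset.mul_sum]
    have e2 : (n : ℝ) * m = ∑ i ∈ Finset.range n, m := by simp
    rw [e1, e2, hA1d, hA2d, hA3d]
    simp only
    rw [Finset.mul_sum, ← Finset.sum_neg_distrib, ← Finset.sum_add_distrib,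
      ← Finset.sum_add_distrib, ← Finset.sum_add_distrib, ← add_sub_assoc, ← Finset.sum_add_distrib]
    congr 1
    refine Finset.sum_congr rfl fun i _ => ?_
    unfold absRemainder
    ring
  have hsub : {ω | κ ≤ |∑ i ∈ Finset.range n, (|ε ((i : ℤ) + 1) ω - a * (1 + x i ω)| -
        |ε ((i : ℤ) + 1) ω|) + v * ((√n)⁻¹ * ∑ i ∈ Finset.range n, Real.sign (ε ((i : ℤ) + 1) ω)) -
        f₀ * v ^ 2|} ⊆
      ({ω | κ / 4 ≤ |a * A1 ω|} ∪ {ω | κ / 4 ≤ |A2 ω|}) ∪ {ω | κ / 4 ≤ |A3 ω|} := by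
    intro ω hω
    simp only [Set.mem_ofPred_eq, Set.mem_union] at hω ⊢
    rw [hdecomp] at hω
    by_contra! hcon
    have h1 := abs_add_le (-(a * A1 ω) + A2 ω + A3 ω) (n * m - f₀ * v ^ 2)
    have h2 := abs_add_le (-(a * A1 ω) + A2 ω) (A3 ω)
    have h3 := abs_add_le (-(a * A1 ω)) (A2 ω)
    rw [abs_neg] at h3
    linarith [hcon.1.1, hcon.1.2, hcon.2]
  refine (measureReal_mono hsub).trans ((measureReal_union_le _ _).trans
    (add_le_add ((measureReal_union_le _ _).trans (add_le_add ?_ ?_)) ?_))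
  · refine (measureReal_abs_ge_le_integral_sq (hA1.const_mul a) hκ4).trans ?_
    gcongr
    simp only [mul_pow]
    rw [integral_const_mul, ← hna]
    calc a ^ 2 * ∫ ω, A1 ω ^ 2 ∂P ≤ a ^ 2 * (n * τ) := by gcongr
      _ = _ := by ring
  · refine (measureReal_abs_ge_le_integral_abs hA2i hκ4).trans ?_
    gcongr
  · refine (measureReal_abs_ge_le_integral_sq hA3 hκ4).trans ?_
    gcongr
    refine hA3'.trans (le_of_eq ?_)
    rw [← hna3]
    ring

end Core

/-! ### Consequences of the noise assumptions -/

namespace NoiseAssumptions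

variable {Ω : Type*} [MeasurableSpace Ω] {P : Measure Ω} {ε : ℤ → Ω → ℝ} {σ : ℝ} {f : ℝ → ℝ}

theorem map_eq (h : NoiseAssumptions P ε σ f) (k : ℤ) :
    P.map (ε k) = volume.withDensity fun x => ENNReal.ofReal (f x) := by
  rw [(h.identDistrib k).map_eq, h.density.2.map_eq]

theorem measure_singleton_zero (h : NoiseAssumptions P ε σ f) (k : ℤ) :
    P.map (ε k) {0} = 0 := by
  rw [h.map_eq]
  exact withDensity_absolutelyContinuous _ _ (measure_singleton 0)

theorem memLp (h : NoiseAssumptions P ε σ f) (k : ℤ) : MemLp (ε k) 2 P :=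
  (h.identDistrib k).memLp_iff.2 h.memLp_two

theorem integral_eq_zero (h : NoiseAssumptions P ε σ f) (k : ℤ) : ∫ ω, ε k ω ∂P = 0 := by
  rw [(h.identDistrib k).integral_eq, h.mean_zero]

theorem integral_sq [IsProbabilityMeasure P] (h : NoiseAssumptions P ε σ f) (k : ℤ) :
    ∫ ω, ε k ω ^ 2 ∂P = σ ^ 2 := by
  have h1 := (h.identDistrib k).variance_eq
  rw [h.variance_eq, variance_eq_sub (h.memLp k), h.integral_eq_zero k] at h1
  simpa using h1

/-- Zero variance would make the noise almost surely constant, whereas a law with a density has no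
atom. -/
theorem sigma_pos [IsProbabilityMeasure P] (h : NoiseAssumptions P ε σ f) : 0 < σ := by
  refine lt_of_le_of_ne h.sigma_nonneg fun h0 => ?_
  have h1 : ε 1 =ᵐ[P] fun _ => 0 := by
    have := ae_eq_integral_of_variance_eq_zero h.memLp_two (by rw [h.variance_eq, ← h0]; simp)
    rwa [h.mean_zero] at this
  have h2 := h.measure_singleton_zero 1
  rw [Measure.map_congr h1, Measure.map_const] at h2
  simp at h2

/-- Without an atom at zero, the median condition gives both open half-lines mass at least, hence
exactly, one half. -/
theorem integral_sign [IsProbabilityMeasure P] (h : NoiseAssumptions P ε σ f) (k : ℤ) :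
    ∫ e, Real.sign e ∂(P.map (ε k)) = 0 := by
  have hm := (h.identDistrib 1).aemeasurable_fst
  rw [(h.identDistrib k).map_eq]
  set μ := P.map (ε 1) with hμ
  have hμP : IsProbabilityMeasure μ := Measure.isProbabilityMeasure_map hm
  have h0 : μ {0} = 0 := h.measure_singleton_zero 1
  have h1 : (1 / 2 : ℝ) ≤ μ.real (Set.Iic 0) := by
    rw [hμ, map_measureReal_apply_of_aemeasurable hm measurableSet_Iic]
    exact h.median_zero.1
  have h2 : (1 / 2 : ℝ) ≤ μ.real (Set.Ici 0) := by
    rw [hμ, map_measureReal_apply_of_aemeasurable hm measurableSet_Ici]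
    exact h.median_zero.2
  have h3 : μ.real (Set.Iic 0) ≤ μ.real (Set.Iio 0) := by
    rw [← Set.Iio_union_right]
    refine (measureReal_union_le _ _).trans ?_
    simp [measureReal_def, h0]
  have h4 : μ.real (Set.Ici 0) ≤ μ.real (Set.Ioi 0) := by
    rw [← Set.Ioi_union_left]
    refine (measureReal_union_le _ _).trans ?_
    simp [measureReal_def, h0]
  have h5 : μ.real (Set.Iio 0) + μ.real (Set.Ici 0) = 1 := by
    rw [← Set.compl_Iio, probReal_add_probReal_compl measurableSet_Iio]
  have h6 : μ.real (Set.Iic 0) + μ.real (Set.Ioi 0) = 1 := by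
    rw [← Set.compl_Iic, probReal_add_probReal_compl measurableSet_Iic]
  have e : ∀ x : ℝ, Real.sign x = (Set.Ioi (0 : ℝ)).indicator (fun _ => (1 : ℝ)) x -
      (Set.Iio (0 : ℝ)).indicator (fun _ => (1 : ℝ)) x := by
    intro x
    rcases lt_trichotomy x 0 with hx | hx | hx
    · simp [Real.sign_of_neg hx, hx, hx.le]
    · simp [hx]
    · simp [Real.sign_of_pos hx, hx, hx.le]
  simp only [e]
  rw [integral_sub ((integrable_const _).indicator measurableSet_Ioi)
    ((integrable_const _).indicator measurableSet_Iio), integral_indicator_const _ measurableSet_Ioi,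
    integral_indicator_const _ measurableSet_Iio]
  simp only [smul_eq_mul, mul_one]
  linarith

theorem exists_lipschitz_bound (h : NoiseAssumptions P ε σ f) :
    ∃ M, ∀ x, |f x - f 0| ≤ M * |x| := by
  obtain ⟨M, hM⟩ := h.deriv_bounded
  refine ⟨M, fun x => ?_⟩
  have h1 := Convex.norm_image_sub_le_of_norm_deriv_le (f := f) (C := M) (s := Set.univ) (x := 0)
    (y := x) (fun z _ => h.differentiable z)
    (fun z _ => hM ⟨z, rfl⟩) convex_univ (Set.mem_univ _) (Set.mem_univ _)
  simpa using h1

/-- The noise may be assumed to be measurable. -/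
theorem exists_measurable (h : NoiseAssumptions P ε σ f) :
    ∃ ε' : ℤ → Ω → ℝ, NoiseAssumptions P ε' σ f ∧ (∀ k, Measurable (ε' k)) ∧
      ∀ k, ε k =ᵐ[P] ε' k := by
  have hm := fun k => (h.identDistrib k).aemeasurable_fst
  have he := fun k => (hm k).ae_eq_mk
  refine ⟨fun k => (hm k).mk (ε k), ?_, fun k => (hm k).measurable_mk, he⟩
  have hid1 : ∀ k, IdentDistrib ((hm k).mk (ε k)) (ε k) P P := fun k =>
    IdentDistrib.of_ae_eq (hm k).measurable_mk.aemeasurable (he k).symm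
  refine ⟨(iIndepFun_congr he).1 h.indep,
    fun k => (hid1 k).trans ((h.identDistrib k).trans (hid1 1).symm),
    (hid1 1).memLp_iff.2 h.memLp_two, by rw [(hid1 1).integral_eq, h.mean_zero], h.sigma_nonneg,
    by rw [(hid1 1).variance_eq, h.variance_eq], ⟨?_, ?_⟩, ⟨h.density.1, ?_⟩, h.differentiable,
    h.density_zero_pos, h.deriv_bounded⟩
  · exact h.median_zero.1.trans_eq
      (congrArg ENNReal.toReal ((hid1 1).measure_mem_eq measurableSet_Iic)).symm
  · exact h.median_zero.2.trans_eq
      (congrArg ENNReal.toReal ((hid1 1).measure_mem_eq measurableSet_Ici)).symm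
  · exact ⟨(hm 1).measurable_mk.aemeasurable, by rw [(hid1 1).map_eq, h.density.2.map_eq]⟩

end NoiseAssumptions

/-! ### The autoregressive process and its deviation from the initial value -/

/-- Only noise up to time `i` is required, with respect to an arbitrary sigma-algebra; taking the
one generated by the past gives adaptedness. -/
theorem arProcess_measurable {Ω : Type*} [MeasurableSpace Ω] {ε : ℤ → Ω → ℝ} {i : ℕ} (r : ℝ)
    (hε : ∀ k ≤ (i : ℤ), Measurable (ε k)) : Measurable (arProcess ε r i) := by
  induction i with
  | zero =>
    refine Measurable.tsum fun j => (hε _ (by simp)).const_mul _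
  | succ i ih =>
    exact ((ih fun k hk => hε k (by push_cast; omega)).const_mul r).add (hε _ (by push_cast; omega))

theorem arProcess_congr {Ω : Type*} [MeasurableSpace Ω] {P : Measure Ω} {ε ε' : ℤ → Ω → ℝ}
    (h : ∀ k, ε k =ᵐ[P] ε' k) (r : ℝ) :
    ∀ᵐ ω ∂P, ∀ i, arProcess ε r i ω = arProcess ε' r i ω := by
  filter_upwards [ae_all_iff.2 h] with ω hω i
  induction i with
  | zero => simp only [arProcess, stationaryInit, hω]
  | succ i ih => simp only [arProcess, ih, hω]

theorem arProcess_eq_pow_mul_add {Ω : Type*} (ε : ℤ → Ω → ℝ) (r : ℝ) (i : ℕ) (ω : Ω) :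
    arProcess ε r i ω = r ^ i * arProcess ε r 0 ω +
      ∑ k ∈ Finset.range i, r ^ (i - 1 - k) * ε ((k : ℤ) + 1) ω := by
  induction i with
  | zero => simp
  | succ i ih =>
    rw [Finset.sum_range_succ]
    simp only [arProcess, ih] at *
    have e : ∑ k ∈ Finset.range i, r ^ (i + 1 - 1 - k) * ε ((k : ℤ) + 1) ω =
        r * ∑ k ∈ Finset.range i, r ^ (i - 1 - k) * ε ((k : ℤ) + 1) ω := by
      rw [Finset.mul_sum]
      refine Finset.sum_congr rfl fun k hk => ?_
      rw [show i + 1 - 1 - k = (i - 1 - k) + 1 by have := Finset.mem_range.1 hk; omega, pow_succ]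
      ring
    rw [e]
    simp
    ring

section

variable {Ω : Type*} [MeasurableSpace Ω] {P : Measure Ω}
  {ε : ℤ → Ω → ℝ} {σ : ℝ} {f : ℝ → ℝ}

/-- By orthogonality only the squared weights matter, and bounding them by one suffices: `n * σ ^ 2`
is already negligible against the variance of `y_0`. -/
theorem integral_weighted_sum_sq_le [IsProbabilityMeasure P] (h : NoiseAssumptions P ε σ f) {r : ℝ} (h0 : 0 < r)
    (h1 : r < 1) (i : ℕ) :
    MemLp (fun ω => ∑ k ∈ Finset.range i, r ^ (i - 1 - k) * ε ((k : ℤ) + 1) ω) 2 P ∧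
    ∫ ω, (∑ k ∈ Finset.range i, r ^ (i - 1 - k) * ε ((k : ℤ) + 1) ω) ^ 2 ∂P ≤ i * σ ^ 2 := by
  have hZ : ∀ k, MemLp (fun ω => r ^ (i - 1 - k) * ε ((k : ℤ) + 1) ω) 2 P := fun k =>
    (h.memLp _).const_mul _
  refine ⟨memLp_finsetSum _ fun k _ => hZ k, ?_⟩
  rw [integral_sum_sq_of_orthogonal (Z := fun k ω => r ^ (i - 1 - k) * ε ((k : ℤ) + 1) ω)
    fun k _ => hZ k]
  · calc _ ≤ ∑ k ∈ Finset.range i, σ ^ 2 := by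
          refine Finset.sum_le_sum fun k _ => ?_
          simp only [mul_pow]
          rw [integral_const_mul, h.integral_sq]
          refine mul_le_of_le_one_left (sq_nonneg σ) ?_
          rw [← pow_mul]
          exact pow_le_one₀ h0.le h1.le
      _ = i * σ ^ 2 := by simp
  · intro j k hjk _
    have h2 : IndepFun (ε ((j : ℤ) + 1)) (ε ((k : ℤ) + 1)) P := h.indep.indepFun (by omega)
    have h3 := h2.integral_fun_mul_eq_mul_integral (h.memLp _).1 (h.memLp _).1
    rw [h.integral_eq_zero, zero_mul] at h3
    have e : ∀ ω, r ^ (i - 1 - j) * ε ((j : ℤ) + 1) ω * (r ^ (i - 1 - k) * ε ((k : ℤ) + 1) ω) =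
        r ^ (i - 1 - j) * r ^ (i - 1 - k) * (ε ((j : ℤ) + 1) ω * ε ((k : ℤ) + 1) ω) := fun ω => by
      ring
    simp only [e]
    rw [integral_const_mul, h3, mul_zero]

/-- The relative deviation of `y_i` from `y_0`, set to zero where `|y_0| ≤ c`. -/
noncomputable def relDeviation {Ω : Type*} (ε : ℤ → Ω → ℝ) (r c : ℝ) (i : ℕ) : Ω → ℝ :=
  {ω | c < |(arProcess ε r 0 ω)|}.indicator fun ω => arProcess ε r i ω / arProcess ε r 0 ω - 1

theorem measurable_relDeviation {Ω : Type*} [MeasurableSpace Ω] {ε : ℤ → Ω → ℝ} {i : ℕ} (r c : ℝ)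
    (hε : ∀ k ≤ (i : ℤ), Measurable (ε k)) : Measurable (relDeviation ε r c i) := by
  have h0 : Measurable (arProcess ε r 0) :=
    arProcess_measurable r fun k hk => hε k (hk.trans (by simp))
  exact (((arProcess_measurable r hε).div h0).sub_const 1).indicator
    (measurableSet_lt measurable_const h0.abs)

/-- Dividing the explicit solution by `y_0` leaves `r ^ i - 1`, controlled by Bernoulli's
inequality, and the accumulated noise over `y_0`, where `|y_0| > c`. The truncation is what makes
second moments available. -/
theorem abs_relDeviation_le {Ω : Type*} {ε : ℤ → Ω → ℝ} {r c : ℝ} (h0 : 0 < r) (h1 : r < 1) (hc : 0 < c) (i : ℕ) (ω : Ω) :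
    |relDeviation ε r c i ω| ≤ i * (1 - r) +
      |∑ k ∈ Finset.range i, r ^ (i - 1 - k) * ε ((k : ℤ) + 1) ω| / c := by
  have hr : 0 ≤ i * (1 - r) := mul_nonneg (by positivity) (by linarith)
  by_cases hω : c < |(arProcess ε r 0 ω)|
  · rw [relDeviation, Set.indicator_of_mem (by exact hω), arProcess_eq_pow_mul_add ε r i ω]
    have hy : arProcess ε r 0 ω ≠ 0 := fun h => by
      rw [h, abs_zero] at hω
      linarith
    rw [add_div, mul_div_cancel_right₀ _ hy, add_sub_right_comm]
    refine (abs_add_le _ _).trans (add_le_add ?_ ?_)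
    · rw [abs_sub_comm, abs_of_nonneg (by linarith [pow_le_one₀ h0.le h1.le (n := i)])]
      have := one_add_mul_le_pow (a := r - 1) (by linarith) i
      rw [add_sub_cancel] at this
      linarith
    · rw [abs_div]
      gcongr
  · rw [relDeviation, Set.indicator_of_notMem (by exact hω), abs_zero]
    positivity

theorem integral_relDeviation_sq_le [IsProbabilityMeasure P] (h : NoiseAssumptions P ε σ f) (hε : ∀ k, Measurable (ε k))
    {r c : ℝ} (h0 : 0 < r) (h1 : r < 1) (hc : 0 < c) {i n : ℕ} (hin : i ≤ n) :
    MemLp (relDeviation ε r c i) 2 P ∧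
    ∫ ω, relDeviation ε r c i ω ^ 2 ∂P ≤ 2 * (n * (1 - r)) ^ 2 + 2 * (n * σ ^ 2 / c ^ 2) := by
  obtain ⟨he, he'⟩ := integral_weighted_sum_sq_le h h0 h1 i
  set e : Ω → ℝ := fun ω => ∑ k ∈ Finset.range i, r ^ (i - 1 - k) * ε ((k : ℤ) + 1) ω
  have hr : 0 ≤ 1 - r := by linarith
  have hec : MemLp (fun ω => |e ω| / c) 2 P := by
    simp only [div_eq_inv_mul]
    exact he.abs.const_mul c⁻¹
  have hesq : Integrable (fun ω => 2 * (e ω ^ 2 / c ^ 2)) P :=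
    (he.integrable_sq.div_const _).const_mul 2
  have hdom : MemLp (fun ω => i * (1 - r) + |e ω| / c) 2 P :=
    (memLp_const (i * (1 - r))).add hec
  have hx : MemLp (relDeviation ε r c i) 2 P :=
    hdom.mono' (measurable_relDeviation r c fun k _ => hε k).aestronglyMeasurable
      (Eventually.of_forall fun ω => abs_relDeviation_le h0 h1 hc i ω)
  refine ⟨hx, ?_⟩
  have hi : Integrable (fun ω => 2 * (i * (1 - r)) ^ 2 + 2 * (e ω ^ 2 / c ^ 2)) P :=
    (integrable_const _).add hesq
  calc ∫ ω, relDeviation ε r c i ω ^ 2 ∂P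
      ≤ ∫ ω, (2 * (i * (1 - r)) ^ 2 + 2 * (e ω ^ 2 / c ^ 2)) ∂P := by
        refine integral_mono hx.integrable_sq hi fun ω => ?_
        have h2 := pow_le_pow_left₀ (abs_nonneg _) (abs_relDeviation_le (ε := ε) h0 h1 hc i ω) 2
        rw [sq_abs] at h2
        refine h2.trans (add_sq_le.trans (le_of_eq ?_))
        rw [div_pow, sq_abs]
        ring
    _ = 2 * (i * (1 - r)) ^ 2 + 2 * ((∫ ω, e ω ^ 2 ∂P) / c ^ 2) := by
        rw [integral_add (integrable_const _) hesq,
          integral_const_mul 2 (fun ω => e ω ^ 2 / c ^ 2), integral_div]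
        simp
    _ ≤ 2 * (n * (1 - r)) ^ 2 + 2 * (n * σ ^ 2 / c ^ 2) := by
        have : (∫ ω, e ω ^ 2 ∂P) ≤ n * σ ^ 2 := he'.trans (by gcongr)
        gcongr

/-! ### Limits of the sign sum and of the initial value -/

/-- The normalised sum of the signs of the noise. -/
noncomputable def signSum (ε : ℤ → Ω → ℝ) (n : ℕ) (ω : Ω) : ℝ :=
  (√n)⁻¹ * ∑ i ∈ Finset.range n, Real.sign (ε ((i : ℤ) + 1) ω)

theorem tendstoInDistribution_signSum [IsProbabilityMeasure P] (h : NoiseAssumptions P ε σ f) :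
    TendstoInDistribution (signSum ε) atTop id (fun _ => P) (gaussianReal 0 1) := by
  have hsm := Real.measurable_sign
  have hm := fun k => (h.identDistrib k).aemeasurable_fst
  refine tendstoInDistribution_inv_sqrt_mul_sum
    (X := fun (i : ℕ) ω => Real.sign (ε ((i : ℤ) + 1) ω)) ⟨aemeasurable_id, Measure.map_id⟩ ?_ ?_ ?_ ?_
  · rw [← integral_map (hm _) hsm.aestronglyMeasurable, h.integral_sign]
  · have h1 : ∀ᵐ ω ∂P, Real.sign (ε (((0 : ℕ) : ℤ) + 1) ω) ^ 2 = 1 := by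
      have h0 := h.measure_singleton_zero (((0 : ℕ) : ℤ) + 1)
      rw [Measure.map_apply_of_aemeasurable (hm _) (measurableSet_singleton 0)] at h0
      filter_upwards [compl_mem_ae_iff.2 h0] with ω hω
      rcases Real.sign_apply_eq_of_ne_zero _ (by simpa using hω) with h | h <;> simp [h]
    simp only [Pi.pow_apply]
    rw [integral_congr_ae h1]
    simp
  · exact (h.indep.precomp (g := fun i : ℕ => (i : ℤ) + 1) fun a b hab => by
      simpa using hab).comp (fun _ => Real.sign) fun _ => hsm
  · exact fun i => ((h.identDistrib _).trans (h.identDistrib _).symm).comp hsm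

theorem integral_signSum_sq_le [IsProbabilityMeasure P] (h : NoiseAssumptions P ε σ f) (hε : ∀ k, Measurable (ε k)) (n : ℕ) :
    MemLp (signSum ε n) 2 P ∧ ∫ ω, signSum ε n ω ^ 2 ∂P ≤ 1 := by
  obtain ⟨h1, h2⟩ := integral_sum_mul_sign_sq_le (n := n) (x := fun _ _ => (1 : ℝ)) (τ := 1) hε
    h.indep h.map_eq (by rw [← h.map_eq 1]; exact h.integral_sign 1) (fun _ => measurable_const)
    (fun _ _ => memLp_const 1) (fun _ _ => by simp)
  simp only [one_mul] at h1 h2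
  refine ⟨h1.const_mul _, ?_⟩
  simp only [signSum, mul_pow]
  rw [integral_const_mul, inv_pow, Real.sq_sqrt (by positivity)]
  rcases Nat.eq_zero_or_pos n with rfl | hn
  · simp
  · rw [inv_mul_le_iff₀ (by exact_mod_cast hn)]
    exact h2

/-- The standardised initial value. -/
noncomputable def stdInit (ε : ℤ → Ω → ℝ) (σ r : ℝ) (ω : Ω) : ℝ :=
  √(1 - r ^ 2) / σ * arProcess ε r 0 ω

theorem tendstoInDistribution_stdInit [IsProbabilityMeasure P] (h : NoiseAssumptions P ε σ f) (hε : ∀ k, Measurable (ε k))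
    {ρ : ℕ → ℝ} (hρ : ∀ n, 1 ≤ n → 0 < ρ n ∧ ρ n < 1) (hρ1 : Tendsto ρ atTop (𝓝 1)) :
    TendstoInDistribution (fun n => stdInit ε σ (ρ n)) atTop id (fun _ => P)
      (gaussianReal 0 1) := by
  have hσ := h.sigma_pos
  have hb : Tendsto (fun n => √(1 - ρ n ^ 2)) atTop (𝓝 0) := by
    have : Tendsto (fun n => √(1 - ρ n ^ 2)) atTop (𝓝 √(1 - 1 ^ 2)) :=
      (Real.continuous_sqrt.tendsto _).comp ((hρ1.pow 2).const_sub 1)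
    simpa using this
  -- The factor `√(1 - ρ n ^ 2)` normalises the geometric squared weights to total one and also
  -- bounds every weight.
  refine tendstoInDistribution_weighted_tsum (X := fun (j : ℕ) ω => ε (-(j : ℤ)) ω / σ)
    (w := fun n j => √(1 - ρ n ^ 2) * ρ n ^ j) ?_ ?_ ?_ ?_
    (fun n => ((arProcess_measurable _ fun k _ => hε k).const_mul _).aemeasurable) ?_ ?_ ?_ hb
  · exact (h.indep.precomp (g := fun j : ℕ => -(j : ℤ)) fun a b hab => by
      simpa using hab).comp (fun _ e => e / σ) fun _ => by fun_prop
  · exact fun j => ((h.identDistrib _).trans (h.identDistrib _).symm).comp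
      (u := fun e => e / σ) (by fun_prop)
  · rw [integral_div, h.integral_eq_zero, zero_div]
  · simp only [Pi.pow_apply, div_pow]
    rw [integral_div, h.integral_sq, div_self (by positivity)]
  · filter_upwards [eventually_ge_atTop 1] with n hn
    filter_upwards [stationaryInit_hasSum h.identDistrib (h.memLp_two.integrable one_le_two)
      (hρ n hn).1 (hρ n hn).2] with ω hω
    have e : (fun j : ℕ => √(1 - ρ n ^ 2) * ρ n ^ j * (ε (-(j : ℤ)) ω / σ)) =
        fun j : ℕ => √(1 - ρ n ^ 2) / σ * (ρ n ^ j * ε (-(j : ℤ)) ω) := funext fun j => by ring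
    rw [e]
    exact hω.mul_left _
  · filter_upwards [eventually_ge_atTop 1] with n hn
    obtain ⟨h0, h1⟩ := hρ n hn
    have h2 : 0 < 1 - ρ n ^ 2 := by nlinarith
    have h3 := (hasSum_geometric_of_lt_one (sq_nonneg (ρ n)) (by linarith)).mul_left (1 - ρ n ^ 2)
    rw [mul_inv_cancel₀ h2.ne'] at h3
    have e : (fun j : ℕ => (√(1 - ρ n ^ 2) * ρ n ^ j) ^ 2) =
        fun j : ℕ => (1 - ρ n ^ 2) * (ρ n ^ 2) ^ j := funext fun j => by
      rw [mul_pow, Real.sq_sqrt h2.le]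
      ring
    rwa [e]
  · filter_upwards [eventually_ge_atTop 1] with n hn j
    obtain ⟨h0, h1⟩ := hρ n hn
    rw [abs_mul, abs_of_nonneg (Real.sqrt_nonneg _), abs_of_nonneg (pow_nonneg h0.le j)]
    exact mul_le_of_le_one_right (Real.sqrt_nonneg _) (pow_le_one₀ h0.le h1.le)

/-- The signs involve noise with positive indices only, the initial value noise with indices at most
zero. -/
theorem indepFun_signSum_stdInit (h : NoiseAssumptions P ε σ f) (hε : ∀ k, Measurable (ε k))
    (n : ℕ) (r : ℝ) : IndepFun (signSum ε n) (stdInit ε σ r) P := by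
  refine indepFun_of_measurable_sigmaOf hε h.indep (S := Set.Ioi 0) (T := Set.Iic 0)
    (by simp) ?_ ?_
  · refine Measurable.const_mul (Finset.measurable_fun_sum _ fun i _ => ?_) _
    exact Real.measurable_sign.comp
      (measurable_sigmaOf ε (S := Set.Ioi 0) (k := (i : ℤ) + 1) (Set.mem_Ioi.2 (by omega)))
  · refine Measurable.const_mul ?_ _
    exact @arProcess_measurable Ω (sigmaOf ε (Set.Iic 0)) ε 0 r fun k hk =>
      measurable_sigmaOf ε (by simpa using hk)

end

/-! ### Locating minimisers by convexity -/

/-- If a convex function is close to a quadratic on a grid of mesh `δ`, then its minimisers are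
close to the vertex of the quadratic. -/
theorem ConvexOn.abs_minimizer_sub_le {H : ℝ → ℝ} (hH : ConvexOn ℝ Set.univ H) {v c H₀ f₀ δ : ℝ}
    (hv : ∀ u, H v ≤ H u) (hf₀ : 0 < f₀) (hδ : 0 < δ) {K : ℤ} (hK : |c| / δ + 3 ≤ K)
    (hgrid : ∀ k ∈ Finset.Icc (-K) K,
      |H (k * δ) - H₀ + 2 * f₀ * c * (k * δ) - f₀ * (k * δ) ^ 2| < f₀ * δ ^ 2 / 2) :
    |v - c| ≤ 3 * δ := by
  set j := round (c / δ) with hj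
  have hjr : |c / δ - j| ≤ 1 / 2 := abs_sub_round _
  have hjc : |c - j * δ| ≤ δ / 2 := by
    rw [show c - j * δ = (c / δ - j) * δ by field_simp, abs_mul, abs_of_pos hδ]
    nlinarith
  have hjK : |(j : ℝ)| + 2 ≤ K := by
    have h1 : |(j : ℝ)| ≤ |c| / δ + 1 / 2 := by
      rw [← abs_of_pos hδ, ← abs_div]
      have := abs_sub_abs_le_abs_sub (j : ℝ) (c / δ)
      rw [abs_sub_comm] at this
      linarith
    linarith
  have hmem : ∀ i : ℤ, |i| ≤ 2 → j + i ∈ Finset.Icc (-K) K := by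
    intro i hi
    have h1 : |j| + 2 ≤ K := by exact_mod_cast hjK
    rw [Finset.mem_Icc]
    have h2 := abs_le.1 hi
    have h3 := abs_le.1 (show |j| ≤ K - 2 by linarith)
    constructor <;> linarith [h2.1, h2.2, h3.1, h3.2]
  have h0 := hgrid _ (hmem 0 (by simp))
  have hp := hgrid _ (hmem 2 (by norm_num))
  have hm := hgrid _ (hmem (-2) (by norm_num))
  push_cast at h0 hp hm
  rw [abs_lt] at h0 hp hm
  obtain ⟨hj1, hj2⟩ := abs_le.1 hjc
  -- From the grid point nearest the vertex to one two steps away, the quadratic rises by at least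
  -- `2 * f₀ * δ ^ 2`, while the two approximation errors total less than `f₀ * δ ^ 2`. One step
  -- might not be enough.
  have hup : H ((j + 0) * δ) < H ((j + 2) * δ) := by
    have := mul_pos (mul_pos hf₀ hδ) (by linarith : 0 < 4 * (j * δ - c) + 3 * δ)
    linarith
  have hdown : H ((j + 0) * δ) < H ((j + -2) * δ) := by
    have := mul_pos (mul_pos hf₀ hδ) (by linarith : 0 < 4 * (c - j * δ) + 3 * δ)
    linarith
  rw [abs_le]
  constructor
  -- A minimiser this far away would have the higher grid point between itself and the lower one,
  -- contradicting convexity. The offset is at most half a step from rounding plus two steps, hence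
  -- below `3 * δ`.
  · by_contra! hlt
    have hI : (j + -2) * δ ∈ Set.Icc v ((j + 0) * δ) := ⟨by linarith, by linarith⟩
    have := hH.le_max_of_mem_Icc (Set.mem_univ _) (Set.mem_univ _) hI
    rw [max_eq_right (hv _)] at this
    linarith
  · by_contra! hlt
    have hI : (j + 2) * δ ∈ Set.Icc ((j + 0) * δ) v := ⟨by linarith, by linarith⟩
    have := hH.le_max_of_mem_Icc (Set.mem_univ _) (Set.mem_univ _) hI
    rw [max_eq_left (hv _)] at this
    linarith

theorem convexOn_sum_abs_sub_mul (n : ℕ) (e c : ℕ → ℝ) (s : ℝ) :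
    ConvexOn ℝ Set.univ fun v : ℝ => ∑ i ∈ Finset.range n, |e i - v / s * c i| := by
  refine ⟨convex_univ, fun u _ v _ α β hα hβ hαβ => ?_⟩
  simp only [smul_eq_mul, Finset.mul_sum]
  rw [← Finset.sum_add_distrib]
  refine Finset.sum_le_sum fun i _ => ?_
  calc |e i - (α * u + β * v) / s * c i|
      = |α * (e i - u / s * c i) + β * (e i - v / s * c i)| := by
        congr 1
        linear_combination (-e i) * hαβ
    _ ≤ |α * (e i - u / s * c i)| + |β * (e i - v / s * c i)| := abs_add_le _ _
    _ = _ := by rw [abs_mul, abs_mul, abs_of_nonneg hα, abs_of_nonneg hβ]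

theorem ladObjective_eq_sum_range (n : ℕ) (y : ℕ → ℝ) (r : ℝ) :
    ladObjective n y r = 1 / (n : ℝ) * ∑ i ∈ Finset.range n, |y (i + 1) - r * y i| := by
  have h := Finset.sum_Ico_add' (fun i => |y i - r * y (i - 1)|) 0 n 1
  simp only [Nat.add_sub_cancel, zero_add] at h
  rw [ladObjective, Finset.range_eq_Ico, h]
  rfl

/-- The least absolute deviation estimation error, when the centred criterion is close to a
quadratic on a grid. -/
theorem abs_lad_error_sub_le {n : ℕ} (hn : 1 ≤ n) {y e : ℕ → ℝ} {r r' : ℝ}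
    (hy : ∀ i, y (i + 1) = r * y i + e i) (hy0 : y 0 ≠ 0) (hr' : IsLADEstimate n y r')
    {f₀ δ S : ℝ} (hf₀ : 0 < f₀) (hδ : 0 < δ) {K : ℤ} (hK : |S / (2 * f₀)| / δ + 3 ≤ K)
    (hgrid : ∀ k ∈ Finset.Icc (-K) K,
      |∑ i ∈ Finset.range n, (|e i - k * δ / √n * (1 + (y i / y 0 - 1))| - |e i|) + k * δ * S -
        f₀ * (k * δ) ^ 2| < f₀ * δ ^ 2 / 2) :
    |√n * y 0 * (r' - r) - S / (2 * f₀)| ≤ 3 * δ := by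
  have hsn : 0 < √(n : ℝ) := Real.sqrt_pos.2 (by exact_mod_cast hn)
  -- The local parameter `v = √n * y 0 * (ρ - r)` makes the regressors `y i / y 0`, which are close
  -- to one.
  have hobj : ∀ v, ∑ i ∈ Finset.range n, |e i - v / √n * (1 + (y i / y 0 - 1))| =
      n * ladObjective n y (r + v / (√n * y 0)) := by
    intro v
    rw [ladObjective_eq_sum_range, ← mul_assoc, mul_one_div_cancel (by positivity), one_mul]
    refine Finset.sum_congr rfl fun i _ => ?_
    rw [hy]
    congr 1
    field_simp
    ring
  refine (convexOn_sum_abs_sub_mul n e (fun i => 1 + (y i / y 0 - 1)) √n).abs_minimizer_sub_le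
    (H₀ := ∑ i ∈ Finset.range n, |e i|) (fun u => ?_) hf₀ hδ hK fun k hk => ?_
  · simp only [hobj]
    refine mul_le_mul_of_nonneg_left ?_ (by positivity)
    have e1 : r + √n * y 0 * (r' - r) / (√n * y 0) = r' := by
      field_simp
      ring
    rw [e1]
    exact hr' _
  · have e1 : 2 * f₀ * (S / (2 * f₀)) = S := by field_simp
    rw [e1, ← Finset.sum_sub_distrib, mul_comm S]
    exact hgrid k hk

/-- A root mean square of `1 + x i` differs from one by at most the root mean square of `x i`. -/
theorem abs_sqrt_mean_sq_sub_one_le {n : ℕ} (hn : 1 ≤ n) (x : ℕ → ℝ) :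
    |√((∑ i ∈ Finset.range n, (1 + x i) ^ 2) / n) - 1| ≤ √((∑ i ∈ Finset.range n, x i ^ 2) / n) := by
  have hn0 : (0 : ℝ) < n := by exact_mod_cast hn
  set m := (∑ i ∈ Finset.range n, x i) / n with hm
  set s := √((∑ i ∈ Finset.range n, x i ^ 2) / n) with hs
  have hs0 : 0 ≤ s := Real.sqrt_nonneg _
  have hs2 : s ^ 2 = (∑ i ∈ Finset.range n, x i ^ 2) / n :=
    Real.sq_sqrt (div_nonneg (Finset.sum_nonneg fun i _ => sq_nonneg _) hn0.le)
  have hms : |m| ≤ s := by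
    rw [← abs_of_nonneg hs0, ← sq_le_sq, hs2, hm, div_pow, div_le_div_iff₀ (by positivity) hn0]
    have := sq_sum_le_card_mul_sum_sq (s := Finset.range n) (f := x)
    rw [Finset.card_range] at this
    nlinarith
  -- With `|m| ≤ s` by Cauchy–Schwarz, the mean square lies between `(1 - s) ^ 2` and `(1 + s) ^ 2`.
  have hq : (∑ i ∈ Finset.range n, (1 + x i) ^ 2) / n = 1 + 2 * m + s ^ 2 := by
    rw [hs2, hm]
    have : ∑ i ∈ Finset.range n, (1 + x i) ^ 2 =
        n + 2 * ∑ i ∈ Finset.range n, x i + ∑ i ∈ Finset.range n, x i ^ 2 := by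
      simp only [add_sq, Finset.sum_add_distrib, Finset.mul_sum]
      simp
    rw [this]
    field_simp
  obtain ⟨h1, h2⟩ := abs_le.1 hms
  rw [hq, abs_sub_le_iff]
  constructor
  · rw [sub_le_iff_le_add]
    exact Real.sqrt_le_iff.2 ⟨by linarith, by nlinarith⟩
  · rw [sub_le_comm]
    exact Real.le_sqrt_of_sq_le (by nlinarith)

/-! ### Linearisation of the estimation error with high probability -/

section

variable {Ω : Type*} [MeasurableSpace Ω] {P : Measure Ω} [IsProbabilityMeasure P]

/-- The normal limit has no atom at zero, so small closed balls carry little limiting mass, and the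
portmanteau theorem transfers this to large `n`. It bounds the cost of truncating at small initial
values. -/
theorem exists_eventually_measureReal_abs_le {X : ℕ → Ω → ℝ}
    (h : TendstoInDistribution X atTop id (fun _ => P) (gaussianReal 0 1)) {κ : ℝ} (hκ : 0 < κ) :
    ∃ η > 0, ∀ᶠ n in atTop, P.real {ω | |X n ω| ≤ η} ≤ κ := by
  have hna := nullSingletonClass_gaussianReal (μ := 0) (v := 1) one_ne_zero
  have h1 := tendsto_measure_cthickening_of_isClosed (μ := gaussianReal 0 1) (s := {0})
    ⟨1, one_pos, measure_ne_top _ _⟩ isClosed_singleton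
  rw [measure_singleton] at h1
  have h2 : ∀ᶠ r in 𝓝[>] (0 : ℝ), gaussianReal 0 1 (Metric.cthickening r {0}) < ENNReal.ofReal κ :=
    (h1.mono_left nhdsWithin_le_nhds).eventually_lt_const (ENNReal.ofReal_pos.2 hκ)
  obtain ⟨η, hηκ, hη⟩ := (h2.and self_mem_nhdsWithin).exists
  rw [Metric.cthickening_singleton _ (le_of_lt hη)] at hηκ
  refine ⟨η, hη, ?_⟩
  have h3 := ProbabilityMeasure.limsup_measure_closed_le_of_tendsto h.tendsto
    (Metric.isClosed_closedBall (x := (0 : ℝ)) (ε := η))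
  simp only [ProbabilityMeasure.coe_mk, Measure.map_id] at h3
  filter_upwards [eventually_lt_of_limsup_lt (h3.trans_lt hηκ)] with n hn
  refine ENNReal.toReal_le_of_le_ofReal hκ.le (le_trans (le_of_eq ?_) hn.le)
  show _ = P.map (X n) _
  rw [Measure.map_apply_of_aemeasurable (h.forall_aemeasurable n)
    Metric.isClosed_closedBall.measurableSet]
  congr 1
  ext ω
  simp

variable {ε : ℤ → Ω → ℝ} {σ : ℝ} {f : ℝ → ℝ} {ρ : ℕ → ℝ}

theorem tendsto_one_of_tendsto_mul_sub_one
    (hlim : Tendsto (fun n : ℕ => (n : ℝ) * (ρ n - 1)) atTop (𝓝 0)) : Tendsto ρ atTop (𝓝 1) := by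
  have h1 : Tendsto (fun n : ℕ => (n : ℝ)⁻¹ * (n * (ρ n - 1)) + 1) atTop (𝓝 (0 * 0 + 1)) :=
    (tendsto_natCast_atTop_atTop.inv_tendsto_atTop.mul hlim).add_const 1
  simp only [mul_zero, zero_add] at h1
  refine h1.congr' ?_
  filter_upwards [eventually_ge_atTop 1] with n hn
  field_simp
  ring

/-- A bound for the mean square of the relative deviations of `y_0, …, y_n` from `y_0`. -/
noncomputable def deviationBound (ρ : ℕ → ℝ) (η : ℝ) (n : ℕ) : ℝ :=
  2 * (n * (1 - ρ n)) ^ 2 + 2 * (n * (1 - ρ n ^ 2) / η ^ 2)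

theorem tendsto_deviationBound
    (hlim : Tendsto (fun n : ℕ => (n : ℝ) * (ρ n - 1)) atTop (𝓝 0)) (η : ℝ) :
    Tendsto (deviationBound ρ η) atTop (𝓝 0) := by
  have h1 : Tendsto (fun n : ℕ => (n : ℝ) * (1 - ρ n)) atTop (𝓝 0) := by
    have := hlim.neg
    rw [neg_zero] at this
    exact this.congr fun n => by ring
  have h2 : Tendsto (fun n : ℕ => (n : ℝ) * (1 - ρ n ^ 2)) atTop (𝓝 0) := by
    have := h1.mul ((tendsto_one_of_tendsto_mul_sub_one hlim).const_add 1)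
    rw [zero_mul] at this
    exact this.congr fun n => by ring
  have h3 := ((h1.pow 2).const_mul 2).add ((h2.div_const (η ^ 2)).const_mul 2)
  rwa [show (2 : ℝ) * 0 ^ 2 + 2 * (0 / η ^ 2) = 0 by simp] at h3

/-- The relative deviation of `y_i` from `y_0`, restricted to `η < |stdInit|`. -/
noncomputable def stdDeviation (ε : ℤ → Ω → ℝ) (σ : ℝ) (ρ : ℕ → ℝ) (η : ℝ) (n i : ℕ) : Ω → ℝ :=
  relDeviation ε (ρ n) (η * σ / √(1 - ρ n ^ 2)) i

theorem integral_stdDeviation_sq_le (h : NoiseAssumptions P ε σ f) (hε : ∀ k, Measurable (ε k))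
    {η : ℝ} (hη : 0 < η) {n i : ℕ} (hρ : 0 < ρ n ∧ ρ n < 1) (hin : i ≤ n) :
    MemLp (stdDeviation ε σ ρ η n i) 2 P ∧
      ∫ ω, stdDeviation ε σ ρ η n i ω ^ 2 ∂P ≤ deviationBound ρ η n := by
  obtain ⟨h0, h1⟩ := hρ
  have h2 : 0 < 1 - ρ n ^ 2 := by nlinarith
  have hσ := h.sigma_pos
  obtain ⟨h3, h4⟩ := integral_relDeviation_sq_le h hε h0 h1
    (c := η * σ / √(1 - ρ n ^ 2)) (by positivity) hin
  refine ⟨h3, h4.trans (le_of_eq ?_)⟩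
  rw [deviationBound, div_pow, Real.sq_sqrt h2.le]
  field_simp

theorem stdDeviation_of_lt {Ω : Type*} {ε : ℤ → Ω → ℝ} (hσ : 0 < σ) {η : ℝ} {n : ℕ} (hρ : 0 < ρ n ∧ ρ n < 1) {ω : Ω}
    (hω : η < |stdInit ε σ (ρ n) ω|) (i : ℕ) :
    stdDeviation ε σ ρ η n i ω = arProcess ε (ρ n) i ω / arProcess ε (ρ n) 0 ω - 1 := by
  obtain ⟨h0, h1⟩ := hρ
  have h2 : 0 < √(1 - ρ n ^ 2) := Real.sqrt_pos.2 (by nlinarith)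
  rw [stdDeviation, relDeviation, Set.indicator_of_mem]
  rw [stdInit, abs_mul, abs_of_pos (by positivity)] at hω
  change η * σ / √(1 - ρ n ^ 2) < |(arProcess ε (ρ n) 0 ω)|
  rw [div_lt_iff₀ h2]
  rw [div_mul_eq_mul_div, lt_div_iff₀ hσ] at hω
  linarith

/-- The centred criterion converges to its quadratic approximation in probability. -/
theorem tendsto_measureReal_criterion (h : NoiseAssumptions P ε σ f) (hε : ∀ k, Measurable (ε k))
    (hρ : ∀ n, 1 ≤ n → 0 < ρ n ∧ ρ n < 1)
    (hlim : Tendsto (fun n : ℕ => (n : ℝ) * (ρ n - 1)) atTop (𝓝 0)) {η κ : ℝ} (hη : 0 < η)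
    (hκ : 0 < κ) (v : ℝ) :
    Tendsto (fun n : ℕ => P.real {ω | κ ≤ |∑ i ∈ Finset.range n,
      (|ε ((i : ℤ) + 1) ω - v / √n * (1 + stdDeviation ε σ ρ η n i ω)| - |ε ((i : ℤ) + 1) ω|) +
        v * signSum ε n ω - f 0 * v ^ 2|}) atTop (𝓝 0) := by
  obtain ⟨M, hM⟩ := h.exists_lipschitz_bound
  have hsgn := h.integral_sign 1
  rw [h.map_eq] at hsgn
  have hμ : IsProbabilityMeasure (volume.withDensity fun x => ENNReal.ofReal (f x)) := by
    rw [← h.map_eq 0]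
    exact Measure.isProbabilityMeasure_map (hε 0).aemeasurable
  set C := 2 * (f 0 + M) + 1
  have hC := fun a => measureReal_abs_le_of_density (a := a) h.density.1 hM rfl
  have hquad := abs_integral_absRemainder_sub_le h.differentiable.continuous.measurable
    h.density.1 hM rfl
  have hv : Tendsto (fun n : ℕ => |v| ^ 3 / √(n : ℝ)) atTop (𝓝 0) :=
    (Real.tendsto_sqrt_atTop.comp tendsto_natCast_atTop_atTop).const_div_atTop _
  have hτ := tendsto_deviationBound hlim η
  have hsτ : Tendsto (fun n => √(deviationBound ρ η n)) atTop (𝓝 0) := by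
    have := (Real.continuous_sqrt.tendsto 0).comp hτ
    rwa [Real.sqrt_zero] at this
  have hbound : Tendsto (fun n : ℕ => v ^ 2 * deviationBound ρ η n / (κ / 4) ^ 2 +
      2 * C * v ^ 2 * (√(deviationBound ρ η n) + deviationBound ρ η n) / (κ / 4) +
        4 * C * (|v| ^ 3 / √n) / (κ / 4) ^ 2) atTop (𝓝 0) := by
    have := (((hτ.const_mul (v ^ 2)).div_const ((κ / 4) ^ 2)).add
      (((hsτ.add hτ).const_mul (2 * C * v ^ 2)).div_const (κ / 4))).add
      ((hv.const_mul (4 * C)).div_const ((κ / 4) ^ 2))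
    simpa using this
  have hsmall : ∀ᶠ n : ℕ in atTop, 4 * M * (|v| ^ 3 / √n) < κ / 4 := by
    have := hv.const_mul (4 * M)
    rw [mul_zero] at this
    exact this.eventually_lt_const (by positivity)
  refine squeeze_zero' (Eventually.of_forall fun n => measureReal_nonneg) ?_ hbound
  filter_upwards [hsmall, eventually_ge_atTop 1] with n hn hn1
  exact measureReal_criterion_sub_quadratic_le hn1 hε h.indep h.map_eq hsgn hC hquad
    (fun i => @measurable_relDeviation Ω (sigmaOf ε (Set.Iic (i : ℤ))) ε i _ _ fun k hk =>
      measurable_sigmaOf ε hk)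
    (fun i hi => (integral_stdDeviation_sq_le h hε hη (hρ n hn1) hi.le).1)
    (fun i hi => (integral_stdDeviation_sq_le h hε hη (hρ n hn1) hi.le).2) hκ hn

theorem measureReal_mean_stdDeviation_le (h : NoiseAssumptions P ε σ f)
    (hε : ∀ k, Measurable (ε k)) {η δ : ℝ} (hη : 0 < η) (hδ : 0 < δ) {n : ℕ} (hn : 1 ≤ n)
    (hρ : 0 < ρ n ∧ ρ n < 1) :
    P.real {ω | δ ≤ √((∑ i ∈ Finset.range n, stdDeviation ε σ ρ η n i ω ^ 2) / n)} ≤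
      deviationBound ρ η n / δ ^ 2 := by
  have hn0 : (0 : ℝ) < n := by exact_mod_cast hn
  have hx := fun i (hi : i ∈ Finset.range n) =>
    integral_stdDeviation_sq_le h hε hη hρ (Finset.mem_range.1 hi).le
  have hi : Integrable (fun ω => (∑ i ∈ Finset.range n, stdDeviation ε σ ρ η n i ω ^ 2) / n) P :=
    (integrable_finsetSum _ fun i hi => (hx i hi).1.integrable_sq).div_const _
  rw [le_div_iff₀' (by positivity)]
  calc δ ^ 2 * P.real {ω | δ ≤ √((∑ i ∈ Finset.range n, stdDeviation ε σ ρ η n i ω ^ 2) / n)}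
      = δ ^ 2 * P.real {ω | δ ^ 2 ≤ (∑ i ∈ Finset.range n, stdDeviation ε σ ρ η n i ω ^ 2) / n} := by
        congr 2
        ext ω
        exact Real.le_sqrt' hδ
    _ ≤ ∫ ω, (∑ i ∈ Finset.range n, stdDeviation ε σ ρ η n i ω ^ 2) / n ∂P :=
        mul_meas_ge_le_integral_of_nonneg (Eventually.of_forall fun ω =>
          div_nonneg (Finset.sum_nonneg fun i _ => sq_nonneg _) hn0.le) hi _
    _ = (∑ i ∈ Finset.range n, ∫ ω, stdDeviation ε σ ρ η n i ω ^ 2 ∂P) / n := by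
        rw [integral_div, integral_finsetSum _ fun i hi => (hx i hi).1.integrable_sq]
    _ ≤ (∑ i ∈ Finset.range n, deviationBound ρ η n) / n := by
        gcongr with i hi
        exact (hx i hi).2
    _ = deviationBound ρ η n := by
        simp
        field_simp

/-- The event on which the least absolute deviation error is close to its linearisation. -/
def LinearisationEvent (ε : ℤ → Ω → ℝ) (σ : ℝ) (f : ℝ → ℝ) (ρ : ℕ → ℝ) (r : ℕ → Ω → ℝ)
    (η M δ : ℝ) (n : ℕ) (ω : Ω) : Prop :=
  η < |stdInit ε σ (ρ n) ω| ∧ |signSum ε n ω| < M ∧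
    |√n * arProcess ε (ρ n) 0 ω * (r n ω - ρ n) - signSum ε n ω / (2 * f 0)| ≤ 3 * δ ∧
    √((∑ i ∈ Finset.range n, (arProcess ε (ρ n) i ω / arProcess ε (ρ n) 0 ω - 1) ^ 2) / n) ≤ δ

theorem eventually_measureReal_not_linearisationEvent_le (h : NoiseAssumptions P ε σ f)
    (hε : ∀ k, Measurable (ε k)) (hρ : ∀ n, 1 ≤ n → 0 < ρ n ∧ ρ n < 1)
    (hlim : Tendsto (fun n : ℕ => (n : ℝ) * (ρ n - 1)) atTop (𝓝 0)) {r : ℕ → Ω → ℝ}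
    (hr : ∀ n, 1 ≤ n → ∀ᵐ ω ∂P, IsLADEstimate n (fun i => arProcess ε (ρ n) i ω) (r n ω))
    {η κ δ M : ℝ} (hη : 0 < η) (hκ : 0 < κ) (hδ : 0 < δ) (hM : 0 < M)
    (hY : ∀ᶠ n in atTop, P.real {ω | |stdInit ε σ (ρ n) ω| ≤ η} ≤ κ) :
    ∀ᶠ n in atTop, P.real {ω | ¬ LinearisationEvent ε σ f ρ r η M δ n ω} ≤
      κ + 1 / M ^ 2 + κ := by
  have hf₀ := h.density_zero_pos
  have hσ := h.sigma_pos
  -- On `|S| < M` the vertex is bounded, so one finite grid, independent of `n` and `ω`, serves all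
  -- sample paths and a union bound applies.
  set K : ℤ := ⌈M / (2 * f 0) / δ + 3⌉ with hK
  set B : ℤ → ℕ → Set Ω := fun k n => {ω | f 0 * δ ^ 2 / 2 ≤ |∑ i ∈ Finset.range n,
      (|ε ((i : ℤ) + 1) ω - k * δ / √n * (1 + stdDeviation ε σ ρ η n i ω)| -
        |ε ((i : ℤ) + 1) ω|) + k * δ * signSum ε n ω - f 0 * (k * δ) ^ 2|} with hB
  set D : ℕ → Set Ω := fun n =>
    {ω | δ ≤ √((∑ i ∈ Finset.range n, stdDeviation ε σ ρ η n i ω ^ 2) / n)} with hD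
  have hsum : Tendsto (fun n => ∑ k ∈ Finset.Icc (-K) K, P.real (B k n) +
      deviationBound ρ η n / δ ^ 2) atTop (𝓝 0) := by
    have h1 := tendsto_finsetSum (Finset.Icc (-K) K) fun k _ =>
      tendsto_measureReal_criterion h hε hρ hlim hη (by positivity : 0 < f 0 * δ ^ 2 / 2) (k * δ)
    have h2 := h1.add ((tendsto_deviationBound hlim η).div_const (δ ^ 2))
    rwa [Finset.sum_const_zero, zero_div, add_zero] at h2
  filter_upwards [hY, hsum.eventually_lt_const hκ, eventually_ge_atTop 1] with n hYn hsn hn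
  have hsub : ∀ᵐ ω ∂P, ω ∈ {ω | ¬ LinearisationEvent ε σ f ρ r η M δ n ω} →
      ω ∈ ({ω | |stdInit ε σ (ρ n) ω| ≤ η} ∪ {ω | M ≤ |signSum ε n ω|}) ∪
        ((⋃ k ∈ Finset.Icc (-K) K, B k n) ∪ D n) := by
    filter_upwards [hr n hn] with ω hω hnot
    by_contra hcon
    simp only [Set.mem_union, not_or, Set.mem_iUnion, not_exists] at hcon
    obtain ⟨⟨h1, h2⟩, h3, h4⟩ := hcon
    have h1 : η < |stdInit ε σ (ρ n) ω| := not_le.1 h1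
    have h2 : |signSum ε n ω| < M := not_le.1 h2
    have h4 : √((∑ i ∈ Finset.range n, stdDeviation ε σ ρ η n i ω ^ 2) / n) < δ := not_le.1 h4
    have hx := stdDeviation_of_lt hσ (hρ n hn) h1
    have hy0 : arProcess ε (ρ n) 0 ω ≠ 0 := fun h0 => by
      rw [stdInit, h0] at h1
      simp at h1
      linarith
    simp only [hx] at h4
    refine hnot ⟨h1, h2, ?_, h4.le⟩
    refine abs_lad_error_sub_le hn (y := fun i => arProcess ε (ρ n) i ω)
      (e := fun i => ε ((i : ℤ) + 1) ω) (fun i => rfl) hy0 hω hf₀ hδ (K := K) ?_ fun k hk => ?_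
    · refine le_trans ?_ (Int.le_ceil _)
      rw [abs_div, abs_of_pos (by positivity : 0 < 2 * f 0)]
      gcongr
    · simp only [← hx]
      exact lt_of_not_ge fun hle => h3 k hk hle
  have hS : P.real {ω | M ≤ |signSum ε n ω|} ≤ 1 / M ^ 2 := by
    obtain ⟨h1, h2⟩ := integral_signSum_sq_le h hε n
    refine (measureReal_abs_ge_le_integral_sq h1 hM).trans ?_
    gcongr
  calc P.real {ω | ¬ LinearisationEvent ε σ f ρ r η M δ n ω}
      ≤ P.real (({ω | |stdInit ε σ (ρ n) ω| ≤ η} ∪ {ω | M ≤ |signSum ε n ω|}) ∪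
        ((⋃ k ∈ Finset.Icc (-K) K, B k n) ∪ D n)) :=
        ENNReal.toReal_mono (measure_ne_top _ _) (measure_mono_ae hsub)
    _ ≤ (P.real {ω | |stdInit ε σ (ρ n) ω| ≤ η} + P.real {ω | M ≤ |signSum ε n ω|}) +
        (∑ k ∈ Finset.Icc (-K) K, P.real (B k n) + P.real (D n)) := by
        refine (measureReal_union_le _ _).trans (add_le_add (measureReal_union_le _ _) ?_)
        exact (measureReal_union_le _ _).trans
          (add_le_add (measureReal_biUnion_finset_le _ _) le_rfl)
    _ ≤ κ + 1 / M ^ 2 + κ := by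
        have := measureReal_mean_stdDeviation_le h hε hη hδ hn (hρ n hn)
        have h5 : ∑ k ∈ Finset.Icc (-K) K, P.real (B k n) + P.real (D n) ≤ κ :=
          (add_le_add le_rfl this).trans hsn.le
        linarith

end

/-! ### Limit laws of the estimator -/

theorem Real.continuousAt_sign {y : ℝ} (hy : y ≠ 0) : ContinuousAt Real.sign y := by
  rcases lt_or_gt_of_ne hy with h | h
  · refine (continuousAt_const (y := (-1 : ℝ))).congr ?_
    filter_upwards [Iio_mem_nhds h] with z hz
    exact (Real.sign_of_neg hz).symm
  · refine (continuousAt_const (y := (1 : ℝ))).congr ?_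
    filter_upwards [Ioi_mem_nhds h] with z hz
    exact (Real.sign_of_pos hz).symm

theorem ae_snd_ne_zero_gaussianReal_prod :
    ∀ᵐ p ∂((gaussianReal 0 1).prod (gaussianReal 0 1)), p.2 ≠ 0 := by
  have h0 : ∀ᵐ y ∂(gaussianReal 0 1), y ≠ 0 := by
    have := nullSingletonClass_gaussianReal (μ := 0) (v := 1) one_ne_zero
    simp [ae_iff]
  exact Measure.quasiMeasurePreserving_snd.ae h0

section

variable {Ω : Type*} [MeasurableSpace Ω] {P : Measure Ω} [IsProbabilityMeasure P]
  {ε : ℤ → Ω → ℝ} {σ : ℝ} {f : ℝ → ℝ} {ρ : ℕ → ℝ}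

theorem tendstoInDistribution_signSum_stdInit (h : NoiseAssumptions P ε σ f)
    (hε : ∀ k, Measurable (ε k)) (hρ : ∀ n, 1 ≤ n → 0 < ρ n ∧ ρ n < 1)
    (hρ1 : Tendsto ρ atTop (𝓝 1)) :
    TendstoInDistribution (fun n ω => (signSum ε n ω, stdInit ε σ (ρ n) ω)) atTop id (fun _ => P)
      ((gaussianReal 0 1).prod (gaussianReal 0 1)) :=
  TendstoInDistribution.prodMk_of_indepFun (tendstoInDistribution_signSum h)
    (tendstoInDistribution_stdInit h hε hρ hρ1) fun n => indepFun_signSum_stdInit h hε n (ρ n)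

theorem tendstoInDistribution_ratio (h : NoiseAssumptions P ε σ f)
    (hε : ∀ k, Measurable (ε k)) (hρ : ∀ n, 1 ≤ n → 0 < ρ n ∧ ρ n < 1)
    (hρ1 : Tendsto ρ atTop (𝓝 1)) :
    TendstoInDistribution (fun n ω => signSum ε n ω / stdInit ε σ (ρ n) ω / (2 * σ * f 0)) atTop
      (fun c : ℝ => c / (2 * σ * f 0)) (fun _ => P) (cauchyMeasure 0 1) := by
  have h1 := TendstoInDistribution.comp_of_ae_continuousAt (g := fun p : ℝ × ℝ => p.1 / p.2)
    (tendstoInDistribution_signSum_stdInit h hε hρ hρ1) (by fun_prop) (by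
      rw [Measure.map_id]
      filter_upwards [ae_snd_ne_zero_gaussianReal_prod] with p hp
      exact continuousAt_fst.div continuousAt_snd hp)
  have h2 := TendstoInDistribution.congr_law (W := id) (ν := cauchyMeasure 0 1) h1 aemeasurable_id
    (by rw [Measure.map_id]; exact map_div_gaussianReal_prod)
  exact h2.continuous_comp (g := fun c : ℝ => c / (2 * σ * f 0)) (by fun_prop)

theorem tendstoInDistribution_sign_mul (h : NoiseAssumptions P ε σ f)
    (hε : ∀ k, Measurable (ε k)) (hρ : ∀ n, 1 ≤ n → 0 < ρ n ∧ ρ n < 1)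
    (hρ1 : Tendsto ρ atTop (𝓝 1)) :
    TendstoInDistribution
      (fun n ω => Real.sign (stdInit ε σ (ρ n) ω) * signSum ε n ω / (2 * f 0)) atTop
      (fun x : ℝ => x) (fun _ => P) (gaussianReal 0 (1 / (4 * f 0 ^ 2)).toNNReal) := by
  have hsm := Real.measurable_sign
  have h1 := TendstoInDistribution.comp_of_ae_continuousAt
    (g := fun p : ℝ × ℝ => Real.sign p.2 * p.1)
    (tendstoInDistribution_signSum_stdInit h hε hρ hρ1) (by fun_prop) (by
      rw [Measure.map_id]
      filter_upwards [ae_snd_ne_zero_gaussianReal_prod] with p hp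
      exact ((Real.continuousAt_sign hp).comp continuousAt_snd).mul continuousAt_fst)
  have h2 := TendstoInDistribution.congr_law (W := id) (ν := gaussianReal 0 1) h1 aemeasurable_id
    (by rw [Measure.map_id]; exact map_sign_mul_gaussianReal_prod)
  have h3 := h2.continuous_comp (g := fun x : ℝ => x / (2 * f 0)) (by fun_prop)
  refine TendstoInDistribution.congr_law h3 aemeasurable_id ?_
  change (gaussianReal 0 1).map (fun x => x / (2 * f 0)) = Measure.map id _
  rw [Measure.map_id, gaussianReal_map_div_const, zero_div]
  congr 1
  ext
  rw [Real.coe_toNNReal _ (by positivity)]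
  simp
  ring

/-- The order of choice matters: `η` and `M` are fixed by the target probability alone, and only
then may `δ` depend on them. Small `|Y|`, large `|S|` and failure of the approximation each cost `κ
/ 4`. -/
theorem tendstoInMeasure_of_linearisationEvent (h : NoiseAssumptions P ε σ f)
    (hε : ∀ k, Measurable (ε k)) (hρ : ∀ n, 1 ≤ n → 0 < ρ n ∧ ρ n < 1)
    (hlim : Tendsto (fun n : ℕ => (n : ℝ) * (ρ n - 1)) atTop (𝓝 0)) {r : ℕ → Ω → ℝ}
    (hr : ∀ n, 1 ≤ n → ∀ᵐ ω ∂P, IsLADEstimate n (fun i => arProcess ε (ρ n) i ω) (r n ω))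
    {X : ℕ → Ω → ℝ}
    (hX : ∀ η > 0, ∀ M > 0, ∀ δ₀ > 0, ∃ δ > 0, ∀ n, 1 ≤ n → ∀ ω,
      LinearisationEvent ε σ f ρ r η M δ n ω → |X n ω| < δ₀) :
    TendstoInMeasure P X atTop 0 := by
  rw [tendstoInMeasure_iff_measureReal_norm]
  intro δ₀ hδ₀
  simp only [Pi.zero_apply, sub_zero, Real.norm_eq_abs]
  rw [tendsto_order]
  refine ⟨fun a ha => Eventually.of_forall fun n => ha.trans_le measureReal_nonneg, fun κ hκ => ?_⟩
  obtain ⟨η, hη, hY⟩ := exists_eventually_measureReal_abs_le (tendstoInDistribution_stdInit h hε hρ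
    (tendsto_one_of_tendsto_mul_sub_one hlim)) (by positivity : 0 < κ / 4)
  have hM : 0 < √(4 / κ) := Real.sqrt_pos.2 (by positivity)
  obtain ⟨δ, hδ, hXδ⟩ := hX η hη √(4 / κ) hM δ₀ hδ₀
  filter_upwards [eventually_measureReal_not_linearisationEvent_le h hε hρ hlim hr hη
    (by positivity) hδ hM hY, eventually_ge_atTop 1] with n hn hn1
  rw [Real.sq_sqrt (by positivity), one_div_div] at hn
  refine (measureReal_mono fun ω (hω : δ₀ ≤ |X n ω|) (hL : LinearisationEvent ε σ f ρ r η _ δ n ω) =>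
    not_lt.2 hω (hXδ n hn1 ω hL)).trans_lt (hn.trans_lt ?_)
  linarith

theorem sqrt_sum_sq_eq {n : ℕ} (hn : 1 ≤ n) (y : ℕ → ℝ) (hy0 : y 0 ≠ 0) :
    √(∑ i ∈ Finset.Icc 1 n, y (i - 1) ^ 2) = √n * |y 0| *
      √((∑ i ∈ Finset.range n, (1 + (y i / y 0 - 1)) ^ 2) / n) := by
  have hn0 : (0 : ℝ) < n := by exact_mod_cast hn
  have h := Finset.sum_Ico_add' (fun i => y (i - 1) ^ 2) 0 n 1
  simp only [Nat.add_sub_cancel, zero_add] at h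
  rw [← Real.sqrt_sq_eq_abs, ← Real.sqrt_mul hn0.le, ← Real.sqrt_mul (by positivity)]
  congr 1
  rw [show Finset.Icc 1 n = Finset.Ico 1 (n + 1) from rfl, ← h, ← Finset.range_eq_Ico,
    mul_div_assoc', mul_assoc, mul_div_cancel_left₀ _ hn0.ne', Finset.mul_sum]
  refine Finset.sum_congr rfl fun i _ => ?_
  field_simp
  ring

theorem tendstoInDistribution_lad_of_measurable (h : NoiseAssumptions P ε σ f)
    (hε : ∀ k, Measurable (ε k)) (hρ : ∀ n, 1 ≤ n → 0 < ρ n ∧ ρ n < 1)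
    (hlim : Tendsto (fun n : ℕ => (n : ℝ) * (ρ n - 1)) atTop (𝓝 0)) {r : ℕ → Ω → ℝ}
    (hrm : ∀ n, 1 ≤ n → AEMeasurable (r n) P)
    (hr : ∀ n, 1 ≤ n → ∀ᵐ ω ∂P, IsLADEstimate n (fun i => arProcess ε (ρ n) i ω) (r n ω)) :
    TendstoInDistribution
        (fun (n : ℕ) ω => √((n : ℝ) / (1 - ρ n ^ 2)) * (r n ω - ρ n)) atTop
        (fun c : ℝ => c / (2 * σ * f 0)) (fun _ => P) (cauchyMeasure 0 1) ∧
      TendstoInDistribution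
        (fun (n : ℕ) ω =>
          √(∑ i ∈ Finset.Icc 1 n, arProcess ε (ρ n) (i - 1) ω ^ 2) * (r n ω - ρ n)) atTop
        (fun x : ℝ => x) (fun _ => P) (gaussianReal 0 (1 / (4 * f 0 ^ 2)).toNNReal) := by
  have hσ := h.sigma_pos
  have hf₀ := h.density_zero_pos
  have hρ1 := tendsto_one_of_tendsto_mul_sub_one hlim
  constructor
  · refine tendstoInDistribution_of_tendstoInMeasure_sub _ _
      (tendstoInDistribution_ratio h hε hρ hρ1)
      (tendstoInMeasure_of_linearisationEvent h hε hρ hlim hr fun η hη M hM δ₀ hδ₀ => ?_) fun n => ?_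
    -- The linearisation error `3 * δ` gets divided by `σ * |Y| > σ * η`.
    · refine ⟨δ₀ * (σ * η) / 4, by positivity, fun n hn ω hL => ?_⟩
      obtain ⟨h1, -, h3, -⟩ := hL
      have h2 : 0 < √(1 - ρ n ^ 2) := Real.sqrt_pos.2 (by nlinarith [hρ n hn])
      have hYpos := hη.trans h1
      have hY0 : stdInit ε σ (ρ n) ω ≠ 0 := abs_pos.1 hYpos
      have hy0 : arProcess ε (ρ n) 0 ω ≠ 0 := fun h0 => hY0 (by rw [stdInit, h0, mul_zero])
      have e : √((n : ℝ) / (1 - ρ n ^ 2)) * (r n ω - ρ n) -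
          signSum ε n ω / stdInit ε σ (ρ n) ω / (2 * σ * f 0) =
          (√n * arProcess ε (ρ n) 0 ω * (r n ω - ρ n) - signSum ε n ω / (2 * f 0)) /
            (σ * stdInit ε σ (ρ n) ω) := by
        rw [Real.sqrt_div (Nat.cast_nonneg n), stdInit]
        field_simp
      simp only [Pi.sub_apply]
      rw [e, abs_div, abs_mul, abs_of_pos hσ, div_lt_iff₀ (by positivity)]
      calc _ ≤ 3 * (δ₀ * (σ * η) / 4) := h3
        _ < δ₀ * (σ * η) := by linarith [mul_pos hδ₀ (mul_pos hσ hη)]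
        _ ≤ δ₀ * (σ * |stdInit ε σ (ρ n) ω|) := by gcongr
    -- Measurability of the estimator is assumed for `n ≥ 1` only; at `n = 0` the square root factor
    -- vanishes.
    · rcases Nat.eq_zero_or_pos n with rfl | hn
      · simp
      · exact ((hrm n hn).sub_const _).const_mul _
  · refine tendstoInDistribution_of_tendstoInMeasure_sub _ _
      (tendstoInDistribution_sign_mul h hε hρ hρ1)
      (tendstoInMeasure_of_linearisationEvent h hε hρ hlim hr fun η hη M hM δ₀ hδ₀ => ?_) fun n => ?_
    -- With `δ ≤ 1` the ratio `q` of root mean squares is at most `2`, so the error is at most `2 *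
    -- (3 * δ) + δ * M / (2 * f 0)`; the second argument of the minimum keeps this below `δ₀`.
    · refine ⟨min 1 (δ₀ / (2 * (6 + M / (2 * f 0)))), by positivity, fun n hn ω hL => ?_⟩
      set δ := min 1 (δ₀ / (2 * (6 + M / (2 * f 0)))) with hδ
      obtain ⟨h1, hS, h3, h4⟩ := hL
      have hδ0 : 0 ≤ δ := by positivity
      have hδ1 : δ ≤ 1 := min_le_left _ _
      have hδ2 : δ * (6 + M / (2 * f 0)) < δ₀ := by
        have : δ ≤ δ₀ / (2 * (6 + M / (2 * f 0))) := min_le_right _ _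
        rw [le_div_iff₀ (by positivity)] at this
        linarith
      have hY0 : stdInit ε σ (ρ n) ω ≠ 0 := abs_pos.1 (hη.trans h1)
      have hy0 : arProcess ε (ρ n) 0 ω ≠ 0 := fun h0 => hY0 (by rw [stdInit, h0, mul_zero])
      have h2 : 0 < √(1 - ρ n ^ 2) / σ :=
        div_pos (Real.sqrt_pos.2 (by nlinarith [hρ n hn])) hσ
      have hsgn : Real.sign (stdInit ε σ (ρ n) ω) = Real.sign (arProcess ε (ρ n) 0 ω) := by
        rcases lt_or_gt_of_ne hy0 with h0 | h0
        · rw [stdInit, Real.sign_of_neg h0, Real.sign_of_neg (mul_neg_of_pos_of_neg h2 h0)]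
        · rw [stdInit, Real.sign_of_pos h0, Real.sign_of_pos (mul_pos h2 h0)]
      have hsabs : |(arProcess ε (ρ n) 0 ω)| =
          Real.sign (arProcess ε (ρ n) 0 ω) * arProcess ε (ρ n) 0 ω := by
        rcases lt_or_gt_of_ne hy0 with h0 | h0
        · rw [Real.sign_of_neg h0, abs_of_neg h0, neg_one_mul]
        · rw [Real.sign_of_pos h0, abs_of_pos h0, one_mul]
      have hsqrt := sqrt_sum_sq_eq hn (fun i => arProcess ε (ρ n) i ω) hy0
      have hq := (abs_sqrt_mean_sq_sub_one_le hn fun i =>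
        arProcess ε (ρ n) i ω / arProcess ε (ρ n) 0 ω - 1).trans h4
      set q := √((∑ i ∈ Finset.range n,
        (1 + (arProcess ε (ρ n) i ω / arProcess ε (ρ n) 0 ω - 1)) ^ 2) / n)
      set s := Real.sign (arProcess ε (ρ n) 0 ω)
      set T := √n * arProcess ε (ρ n) 0 ω * (r n ω - ρ n) with hT
      set c := signSum ε n ω / (2 * f 0) with hc
      have hcM : |c| ≤ M / (2 * f 0) := by
        rw [hc, abs_div, abs_of_pos (by positivity : 0 < 2 * f 0)]
        gcongr
      have e : √(∑ i ∈ Finset.Icc 1 n, arProcess ε (ρ n) (i - 1) ω ^ 2) * (r n ω - ρ n) -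
          Real.sign (stdInit ε σ (ρ n) ω) * signSum ε n ω / (2 * f 0) =
          s * (q * (T - c) + (q - 1) * c) := by
        rw [hsqrt, hsgn, hsabs, hT, hc]
        ring
      have hq2 : |q| ≤ 2 := by
        have := abs_sub_abs_le_abs_sub q 1
        rw [abs_one] at this
        linarith
      simp only [Pi.sub_apply]
      rw [e, abs_mul]
      calc |s| * |q * (T - c) + (q - 1) * c| ≤ 1 * |q * (T - c) + (q - 1) * c| := by
            gcongr
            exact Real.abs_sign_le_one _
        _ ≤ |q| * |T - c| + |q - 1| * |c| := by
            rw [one_mul, ← abs_mul, ← abs_mul]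
            exact abs_add_le _ _
        _ ≤ 2 * (3 * δ) + δ * (M / (2 * f 0)) := by gcongr
        _ = δ * (6 + M / (2 * f 0)) := by ring
        _ < δ₀ := hδ2
    · rcases Nat.eq_zero_or_pos n with rfl | hn
      · simp
      · have hym : ∀ i, Measurable (arProcess ε (ρ n) i) := fun i =>
          arProcess_measurable _ fun k _ => hε k
        exact (Measurable.aemeasurable (by fun_prop)).mul ((hrm n hn).sub_const _)

end

theorem mainTheorem1 {Ω : Type*} [MeasurableSpace Ω] (P : Measure Ω) [IsProbabilityMeasure P]
    (ε : ℤ → Ω → ℝ) (σ : ℝ) (f : ℝ → ℝ) (hε : NoiseAssumptions P ε σ f)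
    (ρ : ℕ → ℝ) (hρ : ∀ n, 1 ≤ n → 0 < ρ n ∧ ρ n < 1)
    (hρ_lim : Tendsto (fun n : ℕ => (n : ℝ) * (ρ n - 1)) atTop (𝓝 0))
    (ρLAD : ℕ → Ω → ℝ) (hLAD_meas : ∀ n, 1 ≤ n → AEMeasurable (ρLAD n) P)
    (hLAD : ∀ n, 1 ≤ n →
      ∀ᵐ ω ∂P, IsLADEstimate n (fun i => arProcess ε (ρ n) i ω) (ρLAD n ω)) :
    TendstoInDistribution
        (fun (n : ℕ) ω => √((n : ℝ) / (1 - ρ n ^ 2)) * (ρLAD n ω - ρ n)) atTop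
        (fun c : ℝ => c / (2 * σ * f 0)) (fun _ => P) (cauchyMeasure 0 1) ∧
      TendstoInDistribution
        (fun (n : ℕ) ω =>
          √(∑ i ∈ Finset.Icc 1 n, arProcess ε (ρ n) (i - 1) ω ^ 2) * (ρLAD n ω - ρ n)) atTop
        (fun x : ℝ => x) (fun _ => P) (gaussianReal 0 (1 / (4 * f 0 ^ 2)).toNNReal) := by
  -- Generated sigma-algebras call for genuinely measurable noise. Modifying countably many
  -- variables on null sets leaves almost every trajectory unchanged.
  obtain ⟨ε', hε', hm, he⟩ := hε.exists_measurable
  obtain ⟨h1, h2⟩ := tendstoInDistribution_lad_of_measurable hε' hm hρ hρ_lim hLAD_meas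
    fun n hn => by
      filter_upwards [hLAD n hn, arProcess_congr he (ρ n)] with ω hω hωe
      simpa only [hωe] using hω
  refine ⟨h1, h2.congr (fun n => ?_) (ae_eq_refl _)⟩
  filter_upwards [arProcess_congr he (ρ n)] with ω hωe
  simp only [hωe]
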